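/- **Theorem 2.5.** Let $n\ge 2$ and let $\lambda_1,\dots,\lambda_{n-1}\in\mathbb C$ (a weight of $sl(n,\mathbb C)$). Let $x_{i,j}$ $(1\le j<i\le n)$ be variables and $\partial_{i,j}=\partial/\partial x_{i,j}$. For $i=1,\dots,n-1$ put $$d_i=\Big(\lambda_i-\sum_{j=i+1}^n x_{j,i}\partial_{j,i}+\sum_{j=i+2}^n x_{j,i+1}\partial_{j,i+1}\Big)\partial_{i+1,i}+\sum_{j=1}^{i-1}x_{i,j}\partial_{i+1,j}-\sum_{j=i+2}^n x_{j,i+1}\partial_{j,i},$$ $$\zeta_i=\lambda_i+\sum_{p=1}^{i-1}(x_{i,p}\partial_{i,p}-x_{i+1,p}\partial_{i+1,p})+\sum_{j=i+2}^n(x_{j,i+1}\partial_{j,i+1}-x_{j,i}\partial_{j,i})-2x_{i+1,i}\partial_{i+1,i}.$$ Let $\mathcal A_0=\mathbb C[x_{i,j}\mid 1\le j\le i-2\le n-2]$ and let $\mathcal A_1$ be the space of formal sums $$\sum_{\vec j\in\mathbb N^{n-1}}\sum_{k=1}^{p} f_{\vec a^k-\vec j}\,x^{\vec a^k-\vec j},\qquad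 p\ge 1,\ \vec a^k\in\mathbb C^{n-1},\ f_{\vec a^k-\vec j}\in\mathcal A_0,\qquad x^{\vec a}=\prod_{i=1}^{n-1}x_{i+1,i}^{a_i}.$$ For $a\in\mathbb C$, with $\langle a\rangle_p=a(a-1)\cdots(a-p+1)$, let $$\eta_i^a=\sum_{p=0}^\infty\frac{\langle a\rangle_p}{p!}\,x_{i+1,i}^{a-p}\Big(\sum_{j=1}^{i-1}x_{i+1,j}\partial_{i,j}\Big)^p .$$ A formal sum $f$ is *weighted*, of weight $\mu=(\mu_1,\dots,\mu_{n-1})\in\mathbb C^{n-1}$, if $\zeta_i(f)=\mu_i f$ for all $i$. Every formal sum $f$ of monomials in the $x_{i,j}$ is the formal sum $\sum_\mu f_\mu$ of its weight components; $f_\mu\in\mathcal A_1$ if $f\in\mathcal A_1$. Let $\widehat{\mathcal A}_1\supseteq\mathcal A_1$ be the space of all formal sums whose weight components all lie in $\mathcal A_1$ (the product of the weight spaces of $\mathcal A_1$), let $\mathcal A_1^{\mathrm{fin}}\subseteq\mathcal A_1$ be the span of the weighted elements of $\mathcal A_1$ (the direct sum of its weight spaces), and put $$\sigma_i(f)=\sum_{\mu}\eta_i^{\mu_i+1}(f_\mu),\qquad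 i=1,\dots,n-1,\ f\in\widehat{\mathcal A}_1 .$$ Then: 1. On $\mathcal A_1$ the series $\eta_i^a$ is coefficientwise finite and maps $\mathcal A_1$ to itself, and the sum defining $\sigma_i(f)$ is coefficientwise finite for $f\in\widehat{\mathcal A}_1$. 2. There is a linear representation of the symmetric group $S_n$ on $\widehat{\mathcal A}_1$ in which the transposition $(i,i+1)$ acts by $\sigma_i$ for $i=1,\dots,n-1$; thus it acts by $\eta_i^{\mu_i+1}$ on the elements of $\mathcal A_1$ of weight $\mu$. It restricts to a representation of $S_n$ on $\mathcal A_1^{\mathrm{fin}}$. 3. For every $\sigma\in S_n$, the element $\sigma(1)$ lies in $\mathcal A_1$, is weighted, and solves the system of partial differential equations $d_i(z)=0$, $i=1,\dots,n-1$, for the singular vectors of $sl(n,\mathbb C)$. -/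

import Mathlib

/-! Throughout, `n` is the rank: the Lie algebra is `sl(n+1, ℂ)`, the symmetric group is
`S_{n+1} = Perm (Fin (n+1))`, and the simple indices are `i : Fin n`, the `i`-th pair of
neighbouring rows being `i.castSucc` and `i.succ`. -/

namespace VermaSing

noncomputable section

/-- Exponents of formal monomials `x^α = ∏ x_{i,j}^{α_{i,j}}`, with complex entries. Only strictly
lower triangular exponents matter; this is imposed in `A1`. -/
abbrev Expo (n : ℕ) : Type := Matrix (Fin (n + 1)) (Fin (n + 1)) ℂ

/-- Formal sums `∑_α f α • x^α`, given by their coefficients. -/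
abbrev Formal (n : ℕ) : Type := Expo n → ℂ

/-- Multiplication by `x_{i,j}^c`, for a complex exponent `c`: the coefficient of `x^α` in
`x_{i,j}^c f` is the coefficient of `x^{α - c ε_{i,j}}` in `f`. -/
def xpow {n : ℕ} (i j : Fin (n + 1)) (c : ℂ) : Module.End ℂ (Formal n) where
  toFun f := fun α => f (α - Matrix.single i j c)
  map_add' _ _ := rfl
  map_smul' _ _ := rfl

/-- Multiplication by the variable `x_{i,j}`. -/
def x {n : ℕ} (i j : Fin (n + 1)) : Module.End ℂ (Formal n) := xpow i j 1

/-- The partial derivative `∂_{i,j}`: it sends `x^α` to `α_{i,j} x^{α - ε_{i,j}}`, term by term. -/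
def pd {n : ℕ} (i j : Fin (n + 1)) : Module.End ℂ (Formal n) where
  toFun f := fun α => (α i j + 1) * f (α + Matrix.single i j 1)
  map_add' f g := by ext α; simp [mul_add]
  map_smul' c f := by ext α; simp [mul_left_comm]

/-- The operator `d_i`, by which `E_{i,i+1}` acts; `d_i(z) = 0` for all `i` is the system of partial
differential equations for the singular vectors. -/
def d {n : ℕ} (lam : Fin n → ℂ) (i : Fin n) : Module.End ℂ (Formal n) :=
  (lam i • (1 : Module.End ℂ (Formal n))
      - ∑ j ∈ Finset.Ioi i.castSucc, x j i.castSucc * pd j i.castSucc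
      + ∑ j ∈ Finset.Ioi i.succ, x j i.succ * pd j i.succ) * pd i.succ i.castSucc
    + ∑ j ∈ Finset.Iio i.castSucc, x i.castSucc j * pd i.succ j
    - ∑ j ∈ Finset.Ioi i.succ, x j i.succ * pd j i.castSucc

/-- The operator `ζ_i`, by which `h_i = E_{i,i} - E_{i+1,i+1}` acts. -/
def zeta {n : ℕ} (lam : Fin n → ℂ) (i : Fin n) : Module.End ℂ (Formal n) :=
  lam i • (1 : Module.End ℂ (Formal n))
    + ∑ p ∈ Finset.Iio i.castSucc,
        (x i.castSucc p * pd i.castSucc p - x i.succ p * pd i.succ p)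
    + ∑ j ∈ Finset.Ioi i.succ,
        (x j i.succ * pd j i.succ - x j i.castSucc * pd j i.castSucc)
    - (2 : ℂ) • (x i.succ i.castSucc * pd i.succ i.castSucc)

/-- `∑_{j < i} x_{i+1,j} ∂_{i,j}`, so that `η_i = x_{i+1,i} + etaTail i`. -/
def etaTail {n : ℕ} (i : Fin n) : Module.End ℂ (Formal n) :=
  ∑ j ∈ Finset.Iio i.castSucc, x i.succ j * pd i.castSucc j

/-- The `p`-th term `(⟨a⟩_p / p!) x_{i+1,i}^{a-p} (∑_{j<i} x_{i+1,j} ∂_{i,j})^p` of `η_i^a`, where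
`⟨a⟩_p = a (a-1) ⋯ (a-p+1)`. -/
def etaTerm {n : ℕ} (i : Fin n) (a : ℂ) (p : ℕ) : Module.End ℂ (Formal n) :=
  ((descPochhammer ℂ p).eval a / (p.factorial : ℂ)) •
    (xpow i.succ i.castSucc (a - p) * etaTail i ^ p)

/-- The complex power `η_i^a = ∑_p etaTerm i a p`, the sum being taken coefficientwise. -/
def etaPow {n : ℕ} (i : Fin n) (a : ℂ) (f : Formal n) : Formal n :=
  fun α => ∑ᶠ p : ℕ, etaTerm i a p f α

/-- The space `𝒜₁` of truncated-up formal power series in the `x_{i+1,i}` (with complex exponents)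
over the polynomial ring `𝒜₀` in the `x_{i,j}` with `j ≤ i - 2`: the exponents of the `x_{i,j}`,
`j ≤ i - 2`, are natural numbers, the exponents of `(x_{2,1}, …, x_{n+1,n})` lie in finitely many
cones `a - ℕⁿ`, and each monomial in `x_{2,1}, …, x_{n+1,n}` has a coefficient that is a
polynomial (finitely many terms). -/
def A1 (n : ℕ) : Submodule ℂ (Formal n) where
  carrier := {f |
    (∀ α, f α ≠ 0 → ∀ i j : Fin (n + 1),
      (i ≤ j → α i j = 0) ∧ ((j : ℕ) + 2 ≤ i → ∃ k : ℕ, α i j = k)) ∧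
    (∃ T : Finset (Fin n → ℂ), ∀ α, f α ≠ 0 →
      ∃ a ∈ T, ∀ i : Fin n, ∃ k : ℕ, α i.succ i.castSucc = a i - k) ∧
    (∀ b : Fin n → ℂ, {α | f α ≠ 0 ∧ ∀ i : Fin n, α i.succ i.castSucc = b i}.Finite)}
  zero_mem' := by
    refine ⟨?_, ⟨∅, ?_⟩, ?_⟩ <;> simp
  add_mem' := by
    classical
    rintro f g ⟨hf1, ⟨T, hf2⟩, hf3⟩ ⟨hg1, ⟨U, hg2⟩, hg3⟩
    have key : ∀ α, (f + g) α ≠ 0 → f α ≠ 0 ∨ g α ≠ 0 := by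
      intro α h
      by_contra! hc
      exact h (by simp [hc.1, hc.2])
    refine ⟨fun α h => (key α h).elim (hf1 α) (hg1 α), ⟨T ∪ U, fun α h => ?_⟩, fun b => ?_⟩
    · rcases key α h with h | h
      · obtain ⟨a, ha, h'⟩ := hf2 α h
        exact ⟨a, Finset.mem_union_left _ ha, h'⟩
      · obtain ⟨a, ha, h'⟩ := hg2 α h
        exact ⟨a, Finset.mem_union_right _ ha, h'⟩
    · refine ((hf3 b).union (hg3 b)).subset ?_
      rintro α ⟨h, h'⟩
      exact (key α h).imp (fun h => ⟨h, h'⟩) (fun h => ⟨h, h'⟩)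
  smul_mem' := by
    rintro c f ⟨hf1, ⟨T, hf2⟩, hf3⟩
    have key : ∀ α, (c • f) α ≠ 0 → f α ≠ 0 := fun α h hc => h (by simp [hc])
    refine ⟨fun α h => hf1 α (key α h), ⟨T, fun α h => hf2 α (key α h)⟩, fun b => ?_⟩
    exact (hf3 b).subset fun α h => ⟨key α h.1, h.2⟩

/-- The constant function `1 = x^0`. -/
def one (n : ℕ) : Formal n := Pi.single 0 1

/-- `f` is weighted of weight `μ`: `ζ_i(f) = μ_i f` for all `i`. -/
def HasWeight {n : ℕ} (lam μ : Fin n → ℂ) (f : Formal n) : Prop :=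
  ∀ i, zeta lam i f = μ i • f

/-- The weight of the monomial `x^α`, i.e. the eigenvalues of the `ζ_i` on it. -/
def wt {n : ℕ} (lam : Fin n → ℂ) (α : Expo n) (i : Fin n) : ℂ :=
  lam i
    + ∑ p ∈ Finset.Iio i.castSucc, (α i.castSucc p - α i.succ p)
    + ∑ j ∈ Finset.Ioi i.succ, (α j i.succ - α j i.castSucc)
    - 2 * α i.succ i.castSucc

open Classical in
/-- The component of weight `μ` of a formal sum: keep the monomials of weight `μ`. -/
def wtComp {n : ℕ} (lam μ : Fin n → ℂ) : Module.End ℂ (Formal n) where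
  toFun f := fun α => if wt lam α = μ then f α else 0
  map_add' f g := by ext α; by_cases h : wt lam α = μ <;> simp [h]
  map_smul' c f := by ext α; by_cases h : wt lam α = μ <;> simp [h]

/-- The operator `σ_i(f) = ∑_μ η_i^{μ(h_i)+1}(f_μ)`, where `f_μ` is the component of weight `μ`. -/
def sigma {n : ℕ} (lam : Fin n → ℂ) (i : Fin n) (f : Formal n) : Formal n :=
  fun α => ∑ᶠ μ : Fin n → ℂ, etaPow i (μ i + 1) (wtComp lam μ f) α

/-- The formal sums all of whose weight components lie in `𝒜₁`: the product of the weight spaces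
of `𝒜₁`. It contains `𝒜₁`. -/
def A1prod {n : ℕ} (lam : Fin n → ℂ) : Submodule ℂ (Formal n) :=
  ⨅ μ : Fin n → ℂ, (A1 n).comap (wtComp lam μ)

/-- The finite sums of weighted elements of `𝒜₁`: the direct sum of the weight spaces of `𝒜₁`. -/
def A1fin {n : ℕ} (lam : Fin n → ℂ) : Submodule ℂ (Formal n) :=
  Submodule.span ℂ {f | f ∈ A1 n ∧ ∃ μ, HasWeight lam μ f}

theorem x_mul_pd_apply {n : ℕ} (i j : Fin (n + 1)) (f : Formal n) (α : Expo n) :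
    (x i j * pd i j) f α = α i j * f α := by
  simp [x, xpow, pd]

theorem zeta_apply {n : ℕ} (lam : Fin n → ℂ) (i : Fin n) (f : Formal n) (α : Expo n) :
    zeta lam i f α = wt lam α i * f α := by
  simp only [zeta, wt, LinearMap.sub_apply, LinearMap.add_apply, LinearMap.smul_apply,
    LinearMap.sum_apply, Pi.sub_apply, Pi.add_apply, Pi.smul_apply, Finset.sum_apply,
    Module.End.one_apply, x_mul_pd_apply, smul_eq_mul, add_mul, sub_mul, Finset.sum_mul, mul_assoc]

theorem hasWeight_wtComp {n : ℕ} (lam μ : Fin n → ℂ) (f : Formal n) :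
    HasWeight lam μ (wtComp lam μ f) := by
  intro i
  ext α
  rw [zeta_apply]
  by_cases h : wt lam α = μ <;> simp [wtComp, h]

theorem A1_le_A1prod {n : ℕ} (lam : Fin n → ℂ) : A1 n ≤ A1prod lam := by
  intro f hf
  obtain ⟨h1, ⟨T, h2⟩, h3⟩ := hf
  rw [A1prod, Submodule.mem_iInf]
  intro μ
  have key : ∀ α, wtComp lam μ f α ≠ 0 → f α ≠ 0 := by
    intro α h hc
    by_cases h' : wt lam α = μ <;> simp [wtComp, h', hc] at h
  exact ⟨fun α h => h1 α (key α h), ⟨T, fun α h => h2 α (key α h)⟩,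
    fun b => (h3 b).subset fun α h => ⟨key α h.1, h.2⟩⟩

theorem one_mem_A1 (n : ℕ) : one n ∈ A1 n := by
  have key : ∀ α, one n α ≠ 0 → α = 0 := by
    intro α h
    by_contra hc
    exact h (by simp [one, hc])
  refine ⟨fun α h i j => ?_, ⟨{0}, fun α h => ?_⟩, fun b => ?_⟩
  · rw [key α h]
    exact ⟨fun _ => rfl, fun _ => ⟨0, by simp⟩⟩
  · rw [key α h]
    exact ⟨0, by simp, fun i => ⟨0, by simp⟩⟩
  · exact (Set.finite_singleton 0).subset fun α h => key α h.1

/-- The constant `1` as an element of the product of the weight spaces of `𝒜₁`. -/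
def oneA1 {n : ℕ} (lam : Fin n → ℂ) : A1prod lam :=
  ⟨one n, A1_le_A1prod lam (one_mem_A1 n)⟩

end

end VermaSing

namespace VermaSing

noncomputable section

open Filter

/-! ### Relations between the elementary operators -/

section Weyl

variable {n : ℕ}

/-! Write `η_i = x_{i+1,i} + T_i` with `T_i = etaTail i`; the two summands commute. On formal sums
whose exponents of the `x_{i,j}`, `j ≤ i - 2`, are natural numbers (`good`), `T_i` raises by one the
natural-valued degree in the `x_{i+1,j}`, `j < i`. The binomial series of `η_i^a` therefore has
finitely many terms in each coefficient, and the Vandermonde convolution gives `η_i^a η_i^b =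
η_i^{a+b}` (`eta_eta`). The degree filtration `fil` justifies every rearrangement of series.

Singular vectors: as in `sl_2`, `[d_i, η_i^a] = a η_i^{a-1} (ζ_i - (a - 1))` (`d_eta_self`), while
`d_k` commutes with `η_i^a` for `k ≠ i` (`d_eta_of_ne`). With `a = μ_i + 1` the correction dies on
weight `μ`, so `η_i^{μ_i+1}` preserves singular vectors. Starting from `1`, which is singular of
weight `λ`, this produces all the `σ(1)`.

Group relations: `η_i^{μ_i+1}` carries weight `μ` to its dot reflection, whose `i`-th exponent is
`-(μ_i + 1)`, so `σ_i² = 1`. For neighbours the braid relation is Verma's identity `η_i^k η_j^{k+m}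
η_i^m = η_j^m η_i^{k+m} η_j^k` (`eta_braid`). With `B = [η_j, η_i]`, which commutes with both,
`conv_eta_eta` moves powers of `η_i` to the left of powers of `η_j`, and both sides become the same
series in `r`, with terms `r! C(k+m,r) C(m,r) η_i^{k+m-r} B^r η_j^{k+m-r}`. Distant `η_i`, `η_j`
commute. The Coxeter presentation, proved by a counting argument (`exists_monoidHom_of_coxeterRel`),
turns these relations into a representation. -/

theorem xpow_apply (p q : Fin (n + 1)) (c : ℂ) (f : Formal n) (α : Expo n) :
    xpow p q c f α = f (α - Matrix.single p q c) := rfl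

theorem x_apply (p q : Fin (n + 1)) (f : Formal n) (α : Expo n) :
    x p q f α = f (α - Matrix.single p q 1) := rfl

theorem pd_apply (p q : Fin (n + 1)) (f : Formal n) (α : Expo n) :
    pd p q f α = (α p q + 1) * f (α + Matrix.single p q 1) := rfl

theorem commute_xpow (p q r s : Fin (n + 1)) (c d : ℂ) :
    Commute (xpow p q c) (xpow r s d) := by
  ext f α
  simp [xpow_apply, Module.End.mul_apply, sub_right_comm]

theorem xpow_mul_xpow (p q : Fin (n + 1)) (c d : ℂ) :
    xpow p q c * xpow p q d = xpow p q (c + d) := by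
  ext f α
  simp [xpow_apply, Module.End.mul_apply, Matrix.single_add, sub_sub]

theorem xpow_zero (p q : Fin (n + 1)) : xpow (n := n) p q 0 = 1 := by
  ext f α
  simp [xpow_apply]

theorem single_apply_of_ne {p q r s : Fin (n + 1)} (h : ¬(p = r ∧ q = s)) (c : ℂ) :
    Matrix.single r s c p q = 0 := by
  rw [Matrix.single_apply, if_neg]
  tauto

theorem commute_pd_xpow {p q r s : Fin (n + 1)} (h : ¬(p = r ∧ q = s)) (c : ℂ) :
    Commute (pd p q) (xpow r s c) := by
  ext f α
  simp [xpow_apply, pd_apply, Module.End.mul_apply, single_apply_of_ne h, add_sub_right_comm]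

theorem commute_pd (p q r s : Fin (n + 1)) : Commute (pd (n := n) p q) (pd r s) := by
  ext f α
  by_cases h : p = r ∧ q = s
  · rw [h.1, h.2]
  · have h' : ¬(r = p ∧ s = q) := by tauto
    simp [pd_apply, Module.End.mul_apply, single_apply_of_ne h, single_apply_of_ne h',
      add_right_comm, mul_left_comm]

theorem pd_mul_xpow_self (p q : Fin (n + 1)) (c : ℂ) :
    pd p q * xpow p q c = xpow p q c * pd p q + c • xpow p q (c - 1) := by
  ext f α
  simp only [xpow_apply, pd_apply, Module.End.mul_apply, LinearMap.add_apply, LinearMap.smul_apply,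
    Pi.add_apply, Pi.smul_apply, Matrix.sub_apply, Matrix.single_apply_same, smul_eq_mul]
  have h1 : α - Matrix.single p q (c - 1) = α + Matrix.single p q 1 - Matrix.single p q c := by
    rw [sub_eq_add_neg c, Matrix.single_add, ← Matrix.single_neg]; abel
  have h2 : α - Matrix.single p q c + Matrix.single p q 1
      = α + Matrix.single p q 1 - Matrix.single p q c := by abel
  rw [h1, h2]
  ring

theorem pd_mul_x_self (p q : Fin (n + 1)) : pd (n := n) p q * x p q = x p q * pd p q + 1 := by
  rw [x, pd_mul_xpow_self, sub_self, xpow_zero, one_smul]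

theorem commute_x_xpow (p q r s : Fin (n + 1)) (d : ℂ) : Commute (x p q) (xpow r s d) :=
  commute_xpow p q r s 1 d

theorem commute_x (p q r s : Fin (n + 1)) : Commute (x (n := n) p q) (x r s) :=
  commute_xpow p q r s 1 1

theorem commute_pd_x {p q r s : Fin (n + 1)} (h : ¬(p = r ∧ q = s)) :
    Commute (pd (n := n) p q) (x r s) :=
  commute_pd_xpow h 1

/-- The tail differentiates only in row `i.castSucc`, so `x_{i+1,i}` is a constant for it. This is
what allows a binomial series for the powers of the sum. -/
theorem commute_etaTail_xpow (i : Fin n) (c : ℂ) :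
    Commute (etaTail i) (xpow i.succ i.castSucc c) := by
  refine Commute.sum_left _ _ _ fun j _ => ?_
  refine Commute.mul_left (commute_x_xpow ..) (commute_pd_xpow ?_ _)
  exact fun h => (Fin.castSucc_lt_succ (i := i)).ne h.1

end Weyl

/-! ### Coefficientwise convergence -/

section Conv

variable {n : ℕ}

/-- Coefficientwise stabilization of a sequence of formal sums. -/
def Conv (u : ℕ → Formal n) (l : Formal n) : Prop := ∀ α, ∀ᶠ N in atTop, u N α = l α

theorem Conv.unique {u : ℕ → Formal n} {l l' : Formal n} (h : Conv u l) (h' : Conv u l') :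
    l = l' := by
  ext α
  obtain ⟨N, hN⟩ := ((h α).and (h' α)).exists
  exact hN.1.symm.trans hN.2

theorem Conv.add {u v : ℕ → Formal n} {l m : Formal n} (h : Conv u l) (h' : Conv v m) :
    Conv (fun N => u N + v N) (l + m) := fun α => by
  filter_upwards [h α, h' α] with N h1 h2
  simp [h1, h2]

theorem Conv.sub {u v : ℕ → Formal n} {l m : Formal n} (h : Conv u l) (h' : Conv v m) :
    Conv (fun N => u N - v N) (l - m) := fun α => by
  filter_upwards [h α, h' α] with N h1 h2
  simp [h1, h2]

theorem Conv.smul {u : ℕ → Formal n} {l : Formal n} (c : ℂ) (h : Conv u l) :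
    Conv (fun N => c • u N) (c • l) := fun α => by
  filter_upwards [h α] with N h1
  simp [h1]

theorem Conv.sum {ι : Type*} (s : Finset ι) {u : ι → ℕ → Formal n} {l : ι → Formal n}
    (h : ∀ k ∈ s, Conv (u k) (l k)) : Conv (fun N => ∑ k ∈ s, u k N) (∑ k ∈ s, l k) := fun α => by
  have := (eventually_all_finset s).2 fun k hk => h k hk α
  filter_upwards [this] with N h1
  simpa using Finset.sum_congr rfl h1

theorem Conv.comp_succ {u : ℕ → Formal n} {l : Formal n} (h : Conv u l) :
    Conv (fun N => u (N + 1)) l := fun α => (tendsto_add_atTop_nat 1).eventually (h α)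

theorem Conv.congr {u v : ℕ → Formal n} {l : Formal n} (h : Conv u l) (huv : ∀ N, u N = v N) :
    Conv v l := (funext huv : u = v) ▸ h

/-- An operator is local if it is continuous for coefficientwise stabilization. -/
def IsLocal (O : Module.End ℂ (Formal n)) : Prop :=
  ∀ u l, Conv u l → Conv (fun N => O (u N)) (O l)

theorem IsLocal.add {O P : Module.End ℂ (Formal n)} (hO : IsLocal O) (hP : IsLocal P) :
    IsLocal (O + P) := fun u l h => (hO u l h).add (hP u l h)

theorem IsLocal.sub {O P : Module.End ℂ (Formal n)} (hO : IsLocal O) (hP : IsLocal P) :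
    IsLocal (O - P) := fun u l h => (hO u l h).sub (hP u l h)

theorem IsLocal.smul (c : ℂ) {O : Module.End ℂ (Formal n)} (hO : IsLocal O) :
    IsLocal (c • O) := fun u l h => (hO u l h).smul c

theorem IsLocal.one : IsLocal (1 : Module.End ℂ (Formal n)) := fun _ _ h => h

theorem IsLocal.mul {O P : Module.End ℂ (Formal n)} (hO : IsLocal O) (hP : IsLocal P) :
    IsLocal (O * P) := fun u l h => hO _ _ (hP u l h)

theorem IsLocal.pow {O : Module.End ℂ (Formal n)} (hO : IsLocal O) (p : ℕ) : IsLocal (O ^ p) := by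
  induction p with
  | zero => exact IsLocal.one
  | succ p ih => rw [pow_succ]; exact ih.mul hO

theorem IsLocal.sum {ι : Type*} (s : Finset ι) {O : ι → Module.End ℂ (Formal n)}
    (h : ∀ k ∈ s, IsLocal (O k)) : IsLocal (∑ k ∈ s, O k) := fun u l hu => by
  simpa using Conv.sum s fun k hk => h k hk u l hu

theorem isLocal_xpow (p q : Fin (n + 1)) (c : ℂ) : IsLocal (xpow p q c) :=
  fun _ _ h α => h (α - Matrix.single p q c)

theorem isLocal_x (p q : Fin (n + 1)) : IsLocal (x (n := n) p q) := isLocal_xpow p q 1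

theorem isLocal_pd (p q : Fin (n + 1)) : IsLocal (pd (n := n) p q) := fun _ _ h α => by
  filter_upwards [h (α + Matrix.single p q 1)] with N hN
  simp [pd_apply, hN]

theorem isLocal_etaTail (i : Fin n) : IsLocal (etaTail i) :=
  IsLocal.sum _ fun _ _ => IsLocal.mul (isLocal_x _ _) (isLocal_pd _ _)

theorem isLocal_etaTerm (i : Fin n) (a : ℂ) (p : ℕ) : IsLocal (etaTerm i a p) :=
  IsLocal.smul _ (IsLocal.mul (isLocal_xpow _ _ _) (IsLocal.pow (isLocal_etaTail i) p))

end Conv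

/-! ### Supports -/

section Support

variable {n : ℕ}

/-- The formal sums supported on monomials with a given property. -/
def supportedOn (P : Expo n → Prop) : Submodule ℂ (Formal n) where
  carrier := {f | ∀ α, f α ≠ 0 → P α}
  zero_mem' := by simp
  add_mem' := by
    intro f g hf hg α h
    by_cases hfα : f α = 0
    · refine hg α fun h' => h ?_
      simp [hfα, h']
    · exact hf α hfα
  smul_mem' := by
    intro c f hf α h
    exact hf α fun h' => h (by simp [h'])

theorem xpow_mem_supportedOn {P Q : Expo n → Prop} {p q : Fin (n + 1)} {c : ℂ}
    (h : ∀ α, P α → Q (α + Matrix.single p q c)) {f : Formal n} (hf : f ∈ supportedOn P) :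
    xpow p q c f ∈ supportedOn Q := fun α hα => by
  simpa using h _ (hf _ hα)

theorem pd_mem_supportedOn {P Q : Expo n → Prop} {p q : Fin (n + 1)}
    (h : ∀ α, P α → α p q ≠ 0 → Q (α - Matrix.single p q 1)) {f : Formal n}
    (hf : f ∈ supportedOn P) : pd p q f ∈ supportedOn Q := fun α hα => by
  rw [pd_apply] at hα
  have := h _ (hf _ (right_ne_zero_of_mul hα))
    (by simpa using left_ne_zero_of_mul hα)
  simpa using this

/-- The exponents of the `x_{i,j}`, `j ≤ i - 2`, are natural numbers. -/
def NatBelow (α : Expo n) : Prop :=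
  ∀ i j : Fin (n + 1), (j : ℕ) + 2 ≤ i → ∃ k : ℕ, α i j = k

theorem NatBelow.add_single {α : Expo n} (h : NatBelow α) (p q : Fin (n + 1)) :
    NatBelow (α + Matrix.single p q 1) := fun i j hij => by
  obtain ⟨k, hk⟩ := h i j hij
  by_cases hpq : i = p ∧ j = q
  · exact ⟨k + 1, by simp [hpq.1, hpq.2, ← hk]⟩
  · exact ⟨k, by simp [single_apply_of_ne hpq, hk]⟩

/-- Differentiation kills exponent `0`, so lowering an exponent never leaves the natural numbers. -/
theorem NatBelow.sub_single {α : Expo n} (h : NatBelow α) {p q : Fin (n + 1)} (h0 : α p q ≠ 0) :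
    NatBelow (α - Matrix.single p q 1) := fun i j hij => by
  obtain ⟨k, hk⟩ := h i j hij
  by_cases hpq : i = p ∧ j = q
  · obtain ⟨rfl, rfl⟩ := hpq
    rcases k with _ | k
    · simp [hk] at h0
    · exact ⟨k, by simp [hk]⟩
  · exact ⟨k, by simp [single_apply_of_ne hpq, hk]⟩

theorem NatBelow.add_single_simple {α : Expo n} (h : NatBelow α) (i : Fin n) (c : ℂ) :
    NatBelow (α + Matrix.single i.succ i.castSucc c) := fun k l hkl => by
  obtain ⟨m, hm⟩ := h k l hkl
  refine ⟨m, ?_⟩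
  rw [Matrix.add_apply, single_apply_of_ne, add_zero, hm]
  rintro ⟨rfl, rfl⟩
  simp at hkl

/-- The sum of the exponents of the variables `x_{i+1,j}`, `j < i`. -/
def rowDeg (i : Fin n) (α : Expo n) : ℂ := ∑ j ∈ Finset.Iio i.castSucc, α i.succ j

theorem rowDeg_add (i : Fin n) (α β : Expo n) : rowDeg i (α + β) = rowDeg i α + rowDeg i β := by
  simp [rowDeg, Finset.sum_add_distrib]

theorem rowDeg_sub (i : Fin n) (α β : Expo n) : rowDeg i (α - β) = rowDeg i α - rowDeg i β := by
  simp [rowDeg, Finset.sum_sub_distrib]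

theorem rowDeg_single_of_ne (i : Fin n) {p q : Fin (n + 1)} (h : ¬(p = i.succ ∧ q < i.castSucc))
    (c : ℂ) : rowDeg i (Matrix.single p q c) = 0 := by
  refine Finset.sum_eq_zero fun j hj => single_apply_of_ne ?_ c
  rintro ⟨rfl, rfl⟩
  exact h ⟨rfl, Finset.mem_Iio.1 hj⟩

theorem rowDeg_single (i : Fin n) {q : Fin (n + 1)} (h : q < i.castSucc) (c : ℂ) :
    rowDeg i (Matrix.single i.succ q c) = c := by
  rw [rowDeg, Finset.sum_eq_single q]
  · simp
  · intro j _ hj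
    exact single_apply_of_ne (by tauto) c
  · simp [h]

theorem exists_rowDeg_eq (i : Fin n) {α : Expo n} (h : NatBelow α) :
    ∃ k : ℕ, rowDeg i α = k := by
  have : ∀ j ∈ Finset.Iio i.castSucc, ∃ k : ℕ, α i.succ j = k := fun j hj =>
    h _ _ (by have := Fin.lt_def.1 (Finset.mem_Iio.1 hj); simp at this ⊢; omega)
  choose! k hk using this
  exact ⟨∑ j ∈ Finset.Iio i.castSucc, k j, by
    rw [rowDeg, Finset.sum_congr rfl hk]; simp⟩

/-- Formal sums with natural exponents of the `x_{i,j}`, `j ≤ i - 2`. -/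
def good (n : ℕ) : Submodule ℂ (Formal n) := supportedOn NatBelow

/-- Elements of `good` whose degree in the variables `x_{i+1,j}`, `j < i`, is at least `M`. -/
def fil (i : Fin n) (M : ℕ) : Submodule ℂ (Formal n) :=
  supportedOn fun α => NatBelow α ∧ ∃ k : ℕ, rowDeg i α = k + M

theorem fil_le_good (i : Fin n) (M : ℕ) : fil i M ≤ good n := fun _ hf α hα => (hf α hα).1

theorem fil_zero (i : Fin n) : fil i 0 = good n := by
  refine le_antisymm (fil_le_good i 0) fun f hf α hα => ⟨hf α hα, ?_⟩
  simpa using exists_rowDeg_eq i (hf α hα)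

theorem fil_anti (i : Fin n) {M N : ℕ} (h : M ≤ N) : fil i N ≤ fil i M := fun f hf α hα => by
  obtain ⟨h1, k, hk⟩ := hf α hα
  refine ⟨h1, k + (N - M), ?_⟩
  rw [hk]; push_cast [h]; ring

/-- A bound for the number of terms of `η_i^a` that contribute to the coefficient of `x^α`. -/
def cut (i : Fin n) (α : Expo n) : ℕ := ⌊‖rowDeg i α‖⌋₊ + 1

/-- On the support the degree is a natural number `k + M`, which equals its own norm, so `cut` is `k
+ M + 1` and exceeds `M`. -/
theorem eq_zero_of_mem_fil {i : Fin n} {M : ℕ} {f : Formal n} (hf : f ∈ fil i M) {α : Expo n}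
    (h : cut i α ≤ M) : f α = 0 := by
  by_contra hα
  obtain ⟨-, k, hk⟩ := hf α hα
  rw [← Nat.cast_add] at hk
  rw [cut, hk, Complex.norm_natCast, Nat.floor_natCast] at h
  omega

theorem conv_zero_of_mem_fil {i : Fin n} {u : ℕ → Formal n} (h : ∀ N, u N ∈ fil i N) :
    Conv u 0 := fun α => by
  filter_upwards [eventually_ge_atTop (cut i α)] with N hN
  exact eq_zero_of_mem_fil (h N) hN

theorem x_mem_good (p q : Fin (n + 1)) {f : Formal n} (hf : f ∈ good n) : x p q f ∈ good n :=
  xpow_mem_supportedOn (fun _ h => h.add_single p q) hf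

theorem pd_mem_good (p q : Fin (n + 1)) {f : Formal n} (hf : f ∈ good n) : pd p q f ∈ good n :=
  pd_mem_supportedOn (fun _ h => h.sub_single) hf

theorem xpow_mem_fil (i j : Fin n) (c : ℂ) {M : ℕ} {f : Formal n} (hf : f ∈ fil i M) :
    xpow j.succ j.castSucc c f ∈ fil i M := by
  refine xpow_mem_supportedOn (fun α h => ⟨h.1.add_single_simple j c, ?_⟩) hf
  rw [rowDeg_add, rowDeg_single_of_ne, add_zero]
  · exact h.2
  · rintro ⟨h1, h2⟩
    rw [Fin.succ_inj.1 h1] at h2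
    exact lt_irrefl _ h2

theorem xpow_mem_good (j : Fin n) (c : ℂ) {f : Formal n} (hf : f ∈ good n) :
    xpow j.succ j.castSucc c f ∈ good n := by
  rw [← fil_zero j] at hf ⊢
  exact xpow_mem_fil j j c hf

/-- Since `p ≠ i.succ`, the derivative does not touch the row in which the degree is measured; the
factor `x` then adds one. -/
theorem x_mul_pd_mem_fil_succ (i : Fin n) {p q s : Fin (n + 1)} (hq : q < i.castSucc)
    (hp : p ≠ i.succ) {M : ℕ} {f : Formal n} (hf : f ∈ fil i M) :
    (x i.succ q * pd p s) f ∈ fil i (M + 1) := by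
  refine xpow_mem_supportedOn (P := fun α => NatBelow α ∧ ∃ k : ℕ, rowDeg i α = k + M)
    (fun α h => ⟨h.1.add_single _ _, ?_⟩)
    (pd_mem_supportedOn (fun α h h0 => ⟨h.1.sub_single h0, ?_⟩) hf)
  · obtain ⟨k, hk⟩ := h.2
    exact ⟨k, by rw [rowDeg_add, rowDeg_single i hq, hk]; push_cast; ring⟩
  · rw [rowDeg_sub, rowDeg_single_of_ne i (by tauto), sub_zero]
    exact h.2

theorem x_mul_pd_mem_fil (i : Fin n) {p q r s : Fin (n + 1)} (hr : r ≠ i.succ)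
    (hp : p ≠ i.succ) {M : ℕ} {f : Formal n} (hf : f ∈ fil i M) :
    (x r q * pd p s) f ∈ fil i M := by
  refine xpow_mem_supportedOn (P := fun α => NatBelow α ∧ ∃ k : ℕ, rowDeg i α = k + M)
    (fun α h => ⟨h.1.add_single _ _, ?_⟩)
    (pd_mem_supportedOn (fun α h h0 => ⟨h.1.sub_single h0, ?_⟩) hf)
  · rw [rowDeg_add, rowDeg_single_of_ne i (by tauto), add_zero]
    exact h.2
  · rw [rowDeg_sub, rowDeg_single_of_ne i (by tauto), sub_zero]
    exact h.2

theorem x_mem_fil_succ (i : Fin n) {q : Fin (n + 1)} (hq : q < i.castSucc) {M : ℕ} {f : Formal n}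
    (hf : f ∈ fil i M) : x i.succ q f ∈ fil i (M + 1) := by
  refine xpow_mem_supportedOn (fun α h => ⟨h.1.add_single _ _, ?_⟩) hf
  obtain ⟨k, hk⟩ := h.2
  exact ⟨k, by rw [rowDeg_add, rowDeg_single i hq, hk]; push_cast; ring⟩

theorem etaTail_mem_fil_succ (i : Fin n) {M : ℕ} {f : Formal n} (hf : f ∈ fil i M) :
    etaTail i f ∈ fil i (M + 1) := by
  rw [etaTail, LinearMap.sum_apply]
  exact Submodule.sum_mem _ fun j hj =>
    x_mul_pd_mem_fil_succ i (Finset.mem_Iio.1 hj) (Fin.castSucc_lt_succ (i := i)).ne hf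

theorem etaTail_pow_mem_fil (i : Fin n) (p : ℕ) {M : ℕ} {f : Formal n} (hf : f ∈ fil i M) :
    (etaTail i ^ p) f ∈ fil i (M + p) := by
  induction p with
  | zero => exact hf
  | succ p ih =>
    rw [pow_succ', Module.End.mul_apply]
    exact etaTail_mem_fil_succ i ih

theorem etaTerm_mem_fil (i : Fin n) (a : ℂ) (p : ℕ) {M : ℕ} {f : Formal n} (hf : f ∈ fil i M) :
    etaTerm i a p f ∈ fil i (M + p) :=
  Submodule.smul_mem _ _ (xpow_mem_fil i i _ (etaTail_pow_mem_fil i p hf))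

theorem etaTail_mem_good (i : Fin n) {f : Formal n} (hf : f ∈ good n) : etaTail i f ∈ good n := by
  rw [← fil_zero i] at hf
  exact fil_le_good i _ (etaTail_mem_fil_succ i hf)

theorem etaTerm_mem_good (i : Fin n) (a : ℂ) (p : ℕ) {f : Formal n} (hf : f ∈ good n) :
    etaTerm i a p f ∈ good n := by
  rw [← fil_zero i] at hf
  exact fil_le_good i _ (etaTerm_mem_fil i a p hf)

end Support

end

end VermaSing

namespace VermaSing

noncomputable section

open Filter

/-! ### Binomial coefficients with complex upper entry -/

section Binomial

theorem descPochhammer_div_factorial (a : ℂ) (p : ℕ) :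
    (descPochhammer ℂ p).eval a / (p.factorial : ℂ) = Ring.choose a p := by
  rw [Ring.choose_eq_smul, ← Polynomial.aeval_eq_smeval, ← Polynomial.eval_map_algebraMap,
    descPochhammer_map, smul_eq_mul, div_eq_inv_mul]

theorem descPochhammer_eval_eq (a : ℂ) (p : ℕ) :
    (descPochhammer ℂ p).eval a = p.factorial * Ring.choose a p := by
  rw [← descPochhammer_div_factorial, mul_div_cancel₀]
  exact Nat.cast_ne_zero.2 p.factorial_ne_zero

/-- Here and in `succ_mul_choose` both sides are `⟨a⟩_{p+1} / p!`. The factors `a - p` and `p + 1`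
come from commuting an operator past `x^{a-p}` and past `T^{p+1}`; both turn coefficients of `η^a`
into `a` times coefficients of `η^{a-1}`. -/
theorem choose_mul_sub (a : ℂ) (p : ℕ) :
    Ring.choose a p * (a - p) = a * Ring.choose (a - 1) p := by
  have h1 := descPochhammer_succ_eval p a
  have h2 : (descPochhammer ℂ (p + 1)).eval a = a * (descPochhammer ℂ p).eval (a - 1) := by
    rw [descPochhammer_succ_left]; simp
  rw [← descPochhammer_div_factorial, ← descPochhammer_div_factorial, div_mul_eq_mul_div, ← h1, h2,
    mul_div_assoc]

theorem succ_mul_choose (a : ℂ) (p : ℕ) :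
    ((p : ℂ) + 1) * Ring.choose a (p + 1) = a * Ring.choose (a - 1) p := by
  have h2 : (descPochhammer ℂ (p + 1)).eval a = a * (descPochhammer ℂ p).eval (a - 1) := by
    rw [descPochhammer_succ_left]; simp
  rw [← descPochhammer_div_factorial, ← descPochhammer_div_factorial, h2, Nat.factorial_succ]
  have : (p : ℂ) + 1 ≠ 0 := Nat.cast_add_one_ne_zero p
  push_cast
  field_simp

theorem choose_add_mul_choose (a : ℂ) (r s : ℕ) :
    Ring.choose a (r + s) * ((r + s).choose r : ℂ) = Ring.choose a r * Ring.choose (a - r) s := by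
  have := Ring.choose_add_smul_choose (a - r) s r
  rw [nsmul_eq_mul, add_comm s r, sub_add_cancel] at this
  rw [mul_comm, this]

end Binomial

/-! ### The complex powers `η_i^a` as linear operators -/

section Eta

variable {n : ℕ}

theorem etaTerm_eq (i : Fin n) (a : ℂ) (p : ℕ) :
    etaTerm i a p = Ring.choose a p • (xpow i.succ i.castSucc (a - p) * etaTail i ^ p) := by
  rw [etaTerm, descPochhammer_div_factorial]

/-- The complex power `η_i^a`, truncated in each coefficient to make it linear on all formal
sums. -/
def eta (i : Fin n) (a : ℂ) : Module.End ℂ (Formal n) where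
  toFun f := fun α => ∑ p ∈ Finset.range (cut i α), etaTerm i a p f α
  map_add' f g := by ext α; simp [Finset.sum_add_distrib]
  map_smul' c f := by ext α; simp [Finset.mul_sum]

theorem eta_apply (i : Fin n) (a : ℂ) (f : Formal n) (α : Expo n) :
    eta i a f α = ∑ p ∈ Finset.range (cut i α), etaTerm i a p f α := rfl

theorem etaTerm_apply_eq_zero {i : Fin n} (a : ℂ) {p : ℕ} {f : Formal n} (hf : f ∈ good n)
    {α : Expo n} (h : cut i α ≤ p) : etaTerm i a p f α = 0 := by
  rw [← fil_zero i] at hf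
  exact eq_zero_of_mem_fil (etaTerm_mem_fil i a p hf) (by omega)

theorem eta_apply_eq_sum {i : Fin n} (a : ℂ) {f : Formal n} (hf : f ∈ good n) {α : Expo n} {N : ℕ}
    (h : cut i α ≤ N) : eta i a f α = ∑ p ∈ Finset.range N, etaTerm i a p f α := by
  rw [eta_apply]
  refine Finset.sum_subset (Finset.range_mono h) fun p _ hp => ?_
  exact etaTerm_apply_eq_zero a hf (by simpa using hp)

theorem finite_etaTerm_ne_zero (i : Fin n) (a : ℂ) {f : Formal n} (hf : f ∈ good n) (α : Expo n) :
    {p : ℕ | etaTerm i a p f α ≠ 0}.Finite := by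
  refine (Finset.range (cut i α)).finite_toSet.subset fun p hp => ?_
  by_contra h
  exact hp (etaTerm_apply_eq_zero a hf (by simpa using h))

theorem etaPow_eq_eta (i : Fin n) (a : ℂ) {f : Formal n} (hf : f ∈ good n) :
    etaPow i a f = eta i a f := by
  ext α
  rw [etaPow, eta_apply]
  refine finsum_eq_finsetSum_of_support_subset _ fun p hp => ?_
  by_contra h
  exact hp (etaTerm_apply_eq_zero a hf (by simpa using h))

theorem conv_eta (i : Fin n) (a : ℂ) {f : Formal n} (hf : f ∈ good n) :
    Conv (fun N => ∑ p ∈ Finset.range N, etaTerm i a p f) (eta i a f) := fun α => by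
  filter_upwards [eventually_ge_atTop (cut i α)] with N hN
  rw [eta_apply_eq_sum a hf hN, Finset.sum_apply]

theorem isLocal_eta (i : Fin n) (a : ℂ) : IsLocal (eta i a) := fun u l h α => by
  have := Conv.sum (Finset.range (cut i α)) (fun p _ => isLocal_etaTerm i a p u l h) α
  filter_upwards [this] with N hN
  simpa [eta_apply] using hN

theorem eta_apply_ne_zero {i : Fin n} {a : ℂ} {f : Formal n} {α : Expo n} (h : eta i a f α ≠ 0) :
    ∃ p, etaTerm i a p f α ≠ 0 := by
  obtain ⟨p, -, hp⟩ := Finset.exists_ne_zero_of_sum_ne_zero ((eta_apply i a f α).symm.trans_ne h)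
  exact ⟨p, hp⟩

theorem eta_mem_good (i : Fin n) (a : ℂ) {f : Formal n} (hf : f ∈ good n) :
    eta i a f ∈ good n := fun α hα => by
  obtain ⟨p, hp⟩ := eta_apply_ne_zero hα
  exact etaTerm_mem_good i a p hf α hp

/-- Controls the remainder of the series, so that inside an operator respecting the filtration
`η_i^a` may be replaced by a partial sum. -/
theorem eta_sub_sum_mem_fil (i : Fin n) (a : ℂ) {f : Formal n} (hf : f ∈ good n) (N : ℕ) :
    eta i a f - ∑ p ∈ Finset.range N, etaTerm i a p f ∈ fil i N := fun α hα => by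
  have h0 : f ∈ fil i 0 := by rwa [fil_zero]
  rw [Pi.sub_apply, eta_apply_eq_sum a hf (le_max_left (cut i α) N), Finset.sum_apply,
    ← Finset.sum_sdiff (Finset.range_mono (le_max_right (cut i α) N)), add_sub_cancel_right] at hα
  obtain ⟨p, hp, hpα⟩ := Finset.exists_ne_zero_of_sum_ne_zero hα
  refine fil_anti i ?_ (etaTerm_mem_fil i a p h0) α hpα
  simp at hp
  omega

theorem etaTerm_zero (i : Fin n) (a : ℂ) : etaTerm i a 0 = xpow i.succ i.castSucc a := by
  simp [etaTerm_eq]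

theorem eta_zero (i : Fin n) {f : Formal n} (hf : f ∈ good n) : eta i 0 f = f := by
  refine (conv_eta i 0 hf).comp_succ.unique fun α => Eventually.of_forall fun N => ?_
  have : ∑ p ∈ Finset.range (N + 1), etaTerm i 0 p f = f := by
    rw [Finset.sum_range_succ', Finset.sum_eq_zero, zero_add, etaTerm_zero, VermaSing.xpow_zero]
    · rfl
    · intro p _
      rw [etaTerm_eq, Ring.choose_zero_succ, zero_smul, LinearMap.zero_apply]
  exact congrFun this α

theorem etaTerm_mul_etaTerm (i : Fin n) (a b : ℂ) (p q : ℕ) :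
    etaTerm i a p * etaTerm i b q = (Ring.choose a p * Ring.choose b q) •
      (xpow i.succ i.castSucc (a + b - (p + q : ℕ)) * etaTail i ^ (p + q)) := by
  have h := ((commute_etaTail_xpow i (b - q)).pow_left p).eq
  rw [etaTerm_eq, etaTerm_eq, smul_mul_smul_comm, mul_assoc, ← mul_assoc (etaTail i ^ p), h,
    mul_assoc, ← mul_assoc, xpow_mul_xpow, ← pow_add]
  congr 4
  push_cast
  ring

/-- The sum of the products of the terms with total index below `N` is a partial sum. -/
theorem sum_etaTerm_mul_etaTerm (i : Fin n) (a b : ℂ) (N : ℕ) :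
    ∑ t ∈ Finset.range N, ∑ z ∈ Finset.HasAntidiagonal.antidiagonal t, etaTerm i a z.1 * etaTerm i b z.2
      = ∑ t ∈ Finset.range N, etaTerm i (a + b) t := by
  refine Finset.sum_congr rfl fun t _ => ?_
  rw [etaTerm_eq, Ring.add_choose_eq t (Commute.all a b), Finset.sum_smul]
  refine Finset.sum_congr rfl fun z hz => ?_
  rw [etaTerm_mul_etaTerm, Finset.HasAntidiagonal.mem_antidiagonal.1 hz]

/-- Summation over a triangle and over a square agree if the difference vanishes. -/
theorem sum_antidiagonal_eq_sum_square {M : Type*} [AddCommMonoid M] (N : ℕ) (F : ℕ → ℕ → M)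
    (h : ∀ p q, N ≤ p + q → F p q = 0) :
    ∑ t ∈ Finset.range N, ∑ z ∈ Finset.HasAntidiagonal.antidiagonal t, F z.1 z.2
      = ∑ p ∈ Finset.range N, ∑ q ∈ Finset.range N, F p q := by
  simp_rw [Finset.Nat.sum_antidiagonal_eq_sum_range_succ F]
  rw [Finset.sum_range_diag_flip]
  refine Finset.sum_congr rfl fun p _ => ?_
  refine Finset.sum_subset (Finset.range_mono (Nat.sub_le _ _)) fun q _ hq => h p q ?_
  simp at hq
  omega

/-- In a fixed coefficient all products of total index at least `cut i α` vanish. The square of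
partial sums is thus a triangle, which the Vandermonde convolution sums along antidiagonals. -/
theorem eta_eta (i : Fin n) (a b : ℂ) {f : Formal n} (hf : f ∈ good n) :
    eta i a (eta i b f) = eta i (a + b) f := by
  have h0 : f ∈ fil i 0 := by rwa [fil_zero]
  ext α
  set N := cut i α
  have hb := eta_mem_good i b hf
  rw [eta_apply_eq_sum a hb le_rfl, eta_apply_eq_sum (a + b) hf le_rfl]
  have key : ∀ p, etaTerm i a p (eta i b f) α
      = ∑ q ∈ Finset.range N, (etaTerm i a p * etaTerm i b q) f α := fun p => by
    have := eq_zero_of_mem_fil (etaTerm_mem_fil i a p (eta_sub_sum_mem_fil i b hf N))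
      (Nat.le_add_right N p)
    rw [map_sub, Pi.sub_apply, sub_eq_zero, map_sum, Finset.sum_apply] at this
    exact this
  have h2 := congrFun (LinearMap.congr_fun (sum_etaTerm_mul_etaTerm i a b N) f) α
  simp only [LinearMap.sum_apply, Finset.sum_apply] at h2
  rw [← h2, sum_antidiagonal_eq_sum_square N
    (fun p q => (etaTerm i a p * etaTerm i b q) f α)]
  · exact Finset.sum_congr rfl fun p _ => key p
  · intro p q hpq
    exact eq_zero_of_mem_fil (etaTerm_mem_fil i a p (etaTerm_mem_fil i b q h0)) (by omega)

end Eta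

/-! ### Commutation of an operator with `η_i^a` -/

section Commutation

variable {n : ℕ}

/-- Operators whose commutators with `x_{i+1,i}^c` and with the tail of `η_i` have the shape that
occurs for the Chevalley generators: `[O, x^c] = c x^{c-1} (Z - (c-1) κ)`, `[O, T] = W`,
`[Z, T] = 0`, `[W, T] = -2 κ T`. -/
structure Derives (i : Fin n) (κ : ℂ) (O Z W : Module.End ℂ (Formal n)) : Prop where
  isLocal : IsLocal O
  mem_good : ∀ f ∈ good n, O f ∈ good n
  mem_good_Z : ∀ f ∈ good n, Z f ∈ good n
  mem_good_W : ∀ f ∈ good n, W f ∈ good n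
  mul_xpow : ∀ c, O * xpow i.succ i.castSucc c = xpow i.succ i.castSucc c * O
    + c • (xpow i.succ i.castSucc (c - 1) * (Z - ((c - 1) * κ) • 1))
  mul_tail : O * etaTail i = etaTail i * O + W
  Z_mul_tail : Commute Z (etaTail i)
  W_mul_tail : W * etaTail i = etaTail i * W - (2 * κ) • etaTail i

variable {i : Fin n} {κ : ℂ} {O Z W : Module.End ℂ (Formal n)}

/-- Moving `O` past each of the `p + 1` factors leaves one `W`. Moving that `W` right past `k`
factors costs `-2κk`, and summing over `k ≤ p` gives `-κ p (p + 1)`. -/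
theorem Derives.mul_tail_pow (h : Derives i κ O Z W) (p : ℕ) :
    O * etaTail i ^ (p + 1) = etaTail i ^ (p + 1) * O
      + ((p : ℂ) + 1) • (etaTail i ^ p * (W - ((p : ℂ) * κ) • 1)) := by
  induction p with
  | zero => simp [h.mul_tail]
  | succ p ih =>
    rw [pow_succ, ← mul_assoc, ih, add_mul, mul_assoc _ O, h.mul_tail, smul_mul_assoc,
      mul_assoc _ _ (etaTail i), sub_mul, h.W_mul_tail, pow_succ]
    push_cast
    simp only [mul_add, mul_sub, mul_assoc, smul_mul_assoc, mul_smul_comm, one_mul, mul_one,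
      smul_sub]
    module

theorem Derives.mul_etaTerm_succ (h : Derives i κ O Z W) (a : ℂ) (p : ℕ) :
    O * etaTerm i a (p + 1) = etaTerm i a (p + 1) * O
      + a • (etaTerm i (a - 1) (p + 1) * (Z - ((a - 1 - (p + 1 : ℕ)) * κ) • 1))
      + a • (etaTerm i (a - 1) p * (W - ((p : ℂ) * κ) • 1)) := by
  have h1 := choose_mul_sub a (p + 1)
  have h2 := succ_mul_choose a p
  have hZ := (h.Z_mul_tail.pow_right (p + 1)).eq
  simp only [etaTerm_eq, smul_mul_assoc, mul_smul_comm, smul_smul, ← h1, ← h2]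
  rw [← mul_assoc, h.mul_xpow, add_mul, mul_assoc _ O, h.mul_tail_pow, smul_mul_assoc, mul_assoc
    _ (Z - _), sub_mul, hZ]
  have e1 : a - ((p + 1 : ℕ) : ℂ) - 1 = a - 1 - ((p + 1 : ℕ) : ℂ) := by ring
  have e2 : a - ((p + 1 : ℕ) : ℂ) = a - 1 - (p : ℂ) := by push_cast; ring
  rw [e1]
  simp only [e2, mul_add, mul_sub, mul_assoc, smul_mul_assoc, mul_smul_comm, one_mul, mul_one,
    smul_sub]
  push_cast
  module

/-- At index `p` the two corrections carry the constants `(a - 1 - p) κ` and `p κ`, whose sum `(a -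
1) κ` does not depend on `p`. They come from consecutive terms of `η^a`, hence the single unpaired
`Z` term of index `N`. -/
theorem Derives.mul_sum (h : Derives i κ O Z W) (a : ℂ) (N : ℕ) :
    O * ∑ p ∈ Finset.range (N + 1), etaTerm i a p
      = (∑ p ∈ Finset.range (N + 1), etaTerm i a p) * O
        + a • ((∑ p ∈ Finset.range N, etaTerm i (a - 1) p) * (Z + W - ((a - 1) * κ) • 1))
        + a • (etaTerm i (a - 1) N * (Z - ((a - 1 - N) * κ) • 1)) := by
  induction N with
  | zero => simp [etaTerm_zero, h.mul_xpow]
  | succ N ih =>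
    rw [Finset.sum_range_succ _ (N + 1), mul_add, ih, h.mul_etaTerm_succ,
      Finset.sum_range_succ (fun p => etaTerm i (a - 1) p) N]
    simp only [add_mul, mul_add, mul_sub, mul_smul_comm, mul_one, smul_sub, smul_add]
    push_cast
    module

theorem Derives.apply_eta (h : Derives i κ O Z W) (a : ℂ) {f : Formal n} (hf : f ∈ good n) :
    O (eta i a f) = eta i a (O f) + a • eta i (a - 1) (Z f + W f - ((a - 1) * κ) • f) := by
  have hg : Z f + W f - ((a - 1) * κ) • f ∈ good n :=
    Submodule.sub_mem _ (Submodule.add_mem _ (h.mem_good_Z f hf) (h.mem_good_W f hf))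
      (Submodule.smul_mem _ _ hf)
  refine (h.isLocal _ _ (conv_eta i a hf).comp_succ).unique ?_
  have h1 := (conv_eta i a (h.mem_good f hf)).comp_succ
  have h2 := (conv_eta i (a - 1) hg).smul a
  -- The unpaired last term lies in `fil i N`, so it disappears in the limit.
  have h3 : Conv (fun N => a • (etaTerm i (a - 1) N * (Z - ((a - 1 - N) * κ) • 1)) f) 0 := by
    refine conv_zero_of_mem_fil (i := i) fun N => Submodule.smul_mem _ _ ?_
    have : (Z - ((a - 1 - N) * κ) • 1) f ∈ fil i 0 := by
      rw [fil_zero]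
      exact Submodule.sub_mem _ (h.mem_good_Z f hf) (Submodule.smul_mem _ _ hf)
    simpa using etaTerm_mem_fil i (a - 1) N this
  have h4 := (h1.add h2).add h3
  rw [add_zero] at h4
  refine h4.congr fun N => ?_
  have := LinearMap.congr_fun (h.mul_sum a N) f
  simp only [LinearMap.add_apply, LinearMap.smul_apply, Module.End.mul_apply, LinearMap.sum_apply,
    LinearMap.sub_apply, Module.End.one_apply] at this ⊢
  exact this.symm

/-- A local operator that commutes with `x_{i+1,i}^c` and the tail of `η_i` commutes with
`η_i^a`. -/
theorem commute_eta (hO : IsLocal O) (hg : ∀ f ∈ good n, O f ∈ good n)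
    (hx : ∀ c, Commute O (xpow i.succ i.castSucc c)) (hT : Commute O (etaTail i)) (a : ℂ)
    {f : Formal n} (hf : f ∈ good n) : O (eta i a f) = eta i a (O f) := by
  have h : Derives i 0 O 0 0 :=
    { isLocal := hO
      mem_good := hg
      mem_good_Z := by simp
      mem_good_W := by simp
      mul_xpow := by simp [(hx _).eq]
      mul_tail := by simp [hT.eq]
      Z_mul_tail := Commute.zero_left _
      W_mul_tail := by simp }
  simpa using h.apply_eta a hf

end Commutation

end

end VermaSing

namespace VermaSing

noncomputable section

open Filter Finset.HasAntidiagonal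

/-! ### The Verma identities for complex powers -/

section Verma

variable {n : ℕ}

theorem pd_mul_x (p q r s : Fin (n + 1)) :
    pd (n := n) p q * x r s = x r s * pd p q + if p = r ∧ q = s then 1 else 0 := by
  split_ifs with h
  · rw [← h.1, ← h.2, pd_mul_x_self]
  · rw [(commute_pd_x h).eq, add_zero]

theorem xpd_mul_xpd (p q r s t u v w : Fin (n + 1)) :
    (x (n := n) p q * pd r s) * (x t u * pd v w) = (x t u * pd v w) * (x p q * pd r s)
      + (if r = t ∧ s = u then x p q * pd v w else 0)
      - (if v = p ∧ w = q then x t u * pd r s else 0) := by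
  rw [mul_assoc, ← mul_assoc (pd r s), pd_mul_x, mul_assoc (x t u), ← mul_assoc (pd v w),
    pd_mul_x, add_mul, add_mul, mul_add, mul_add, mul_assoc, mul_assoc, (commute_pd r s v w).eq,
    ← mul_assoc (x p q), (commute_x p q t u).eq, mul_assoc (x t u), add_assoc, add_sub_assoc]
  congr 1
  split_ifs <;> simp

theorem commute_xpd {p q r s t u v w : Fin (n + 1)} (h : ¬(r = t ∧ s = u)) (h' : ¬(v = p ∧ w = q)) :
    Commute (x (n := n) p q * pd r s) (x t u * pd v w) := by
  rw [Commute, SemiconjBy, xpd_mul_xpd, if_neg h, if_neg h', add_zero, sub_zero]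

/-- The operator `∑_{k ∈ s} x_{a,k} ∂_{b,k}`. -/
def rowOp (s : Finset (Fin (n + 1))) (a b : Fin (n + 1)) : Module.End ℂ (Formal n) :=
  ∑ k ∈ s, x a k * pd b k

theorem etaTail_eq_rowOp (i : Fin n) :
    etaTail i = rowOp (Finset.Iio i.castSucc) i.succ i.castSucc := rfl

/-- The row operators multiply like matrix units, `[E_{ab}, E_{bc}] = E_{ac}`; the condition `c ≠ a`
removes the other commutator term. -/
theorem rowOp_mul_rowOp (s : Finset (Fin (n + 1))) {a b c : Fin (n + 1)} (h : c ≠ a) :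
    rowOp s a b * rowOp s b c = rowOp s b c * rowOp s a b + rowOp s a c := by
  simp only [rowOp, Finset.sum_mul_sum]
  rw [Finset.sum_congr rfl fun k _ => Finset.sum_congr rfl fun l _ => xpd_mul_xpd a k b k b l c l]
  simp only [h, false_and, if_false, sub_zero, Finset.sum_add_distrib]
  rw [Finset.sum_comm]
  congr 1
  refine Finset.sum_congr rfl fun k hk => ?_
  simp [hk]

theorem commute_rowOp (s t : Finset (Fin (n + 1))) {a b c d : Fin (n + 1)} (h : b ≠ c)
    (h' : d ≠ a) : Commute (rowOp (n := n) s a b) (rowOp t c d) :=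
  Commute.sum_left _ _ _ fun _ _ => Commute.sum_right _ _ _ fun _ _ =>
    commute_xpd (fun e => h e.1) (fun e => h' e.1)

theorem commute_rowOp_xpow (s : Finset (Fin (n + 1))) {a b p q : Fin (n + 1)}
    (h : ¬(b = p ∧ q ∈ s)) (c : ℂ) : Commute (rowOp (n := n) s a b) (xpow p q c) :=
  Commute.sum_left _ _ _ fun k hk => Commute.mul_left (commute_x_xpow ..)
    (commute_pd_xpow (by rintro ⟨rfl, rfl⟩; exact h ⟨rfl, hk⟩) c)

theorem isLocal_rowOp (s : Finset (Fin (n + 1))) (a b : Fin (n + 1)) :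
    IsLocal (rowOp (n := n) s a b) :=
  IsLocal.sum _ fun _ _ => IsLocal.mul (isLocal_x _ _) (isLocal_pd _ _)

theorem rowOp_mem_good (s : Finset (Fin (n + 1))) (a b : Fin (n + 1)) {f : Formal n}
    (hf : f ∈ good n) : rowOp s a b f ∈ good n := by
  rw [rowOp, LinearMap.sum_apply]
  exact Submodule.sum_mem _ fun k _ => x_mem_good _ _ (pd_mem_good _ _ hf)

theorem pow_mem_good {O : Module.End ℂ (Formal n)} (h : ∀ f ∈ good n, O f ∈ good n) (r : ℕ) :
    ∀ f ∈ good n, (O ^ r) f ∈ good n := by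
  induction r with
  | zero => simp
  | succ r ih =>
    intro f hf
    rw [pow_succ, Module.End.mul_apply]
    exact ih _ (h f hf)

/-- The commutator `[η_j, η_i]` for neighbouring `i`, `j = i + 1`. -/
def etaBracket (i j : Fin n) : Module.End ℂ (Formal n) :=
  x j.succ i.castSucc + rowOp (Finset.Iio i.castSucc) j.succ i.castSucc

variable {i j : Fin n}

theorem Iio_castSucc_eq (hij : j.castSucc = i.succ) :
    Finset.Iio j.castSucc = insert i.castSucc (Finset.Iio i.castSucc) := by
  ext k
  simp only [Finset.mem_Iio, Finset.mem_insert, hij, Fin.lt_def, Fin.ext_iff, Fin.val_succ,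
    Fin.val_castSucc]
  omega

theorem castSucc_lt_of_eq (hij : j.castSucc = i.succ) : i.castSucc < j.castSucc :=
  hij ▸ Fin.castSucc_lt_succ

theorem castSucc_ne_succ_of_eq (hij : j.castSucc = i.succ) : i.castSucc ≠ j.succ :=
  ((castSucc_lt_of_eq hij).trans Fin.castSucc_lt_succ).ne

theorem etaTail_eq_add (hij : j.castSucc = i.succ) :
    etaTail j = x j.succ i.castSucc * pd i.succ i.castSucc
      + rowOp (Finset.Iio i.castSucc) j.succ i.succ := by
  rw [etaTail, Iio_castSucc_eq hij, Finset.sum_insert (by simp), hij]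
  rfl

/-- For neighbours, `T_j` differentiates the row that contains `x_{i+1,i}`. The commutator with
`x_{i+1,i}^c` gives the first summand of `etaBracket i j` and that with `T_i` the second; both
commute with `η_i`, whence `κ = 0`. -/
theorem derives_etaTail (hij : j.castSucc = i.succ) :
    Derives i 0 (etaTail j) (x j.succ i.castSucc)
      (rowOp (Finset.Iio i.castSucc) j.succ i.castSucc) where
  isLocal := isLocal_etaTail j
  mem_good _ hf := etaTail_mem_good j hf
  mem_good_Z _ hf := x_mem_good _ _ hf
  mem_good_W _ hf := rowOp_mem_good _ _ _ hf
  mul_xpow c := by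
    have h1 := (commute_rowOp_xpow (Finset.Iio i.castSucc) (a := j.succ) (b := i.succ)
      (p := i.succ) (q := i.castSucc) (by simp) c).eq
    rw [etaTail_eq_add hij, add_mul, h1, mul_assoc, pd_mul_xpow_self, mul_add, mul_add, ← mul_assoc,
      (commute_x_xpow ..).eq, mul_smul_comm, (commute_x_xpow ..).eq]
    simp only [mul_zero, zero_smul, sub_zero, mul_assoc]
    abel
  mul_tail := by
    have h0 := castSucc_ne_succ_of_eq hij
    have h1 : Commute (x (n := n) j.succ i.castSucc * pd i.succ i.castSucc) (etaTail i) :=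
      Commute.sum_right _ _ _ fun k hk =>
        commute_xpd (fun e => (Finset.mem_Iio.1 hk).ne e.2.symm) (fun e => h0 e.1)
    rw [etaTail_eq_add hij, add_mul, h1.eq, etaTail_eq_rowOp, rowOp_mul_rowOp _ h0, mul_add]
    abel
  Z_mul_tail := (commute_rowOp_xpow _ (fun e => castSucc_ne_succ_of_eq hij e.1) 1).symm
  W_mul_tail := by
    have := (commute_rowOp (n := n) (Finset.Iio i.castSucc) (Finset.Iio i.castSucc)
      (a := j.succ) (b := i.castSucc) (c := i.succ) (d := i.castSucc)
      (Fin.castSucc_lt_succ (i := i)).ne (castSucc_ne_succ_of_eq hij)).eq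
    rw [etaTail_eq_rowOp, this]
    simp

theorem etaTail_eta (hij : j.castSucc = i.succ) (m : ℂ) {f : Formal n} (hf : f ∈ good n) :
    etaTail j (eta i m f) = eta i m (etaTail j f) + m • eta i (m - 1) (etaBracket i j f) := by
  rw [(derives_etaTail hij).apply_eta m hf, mul_zero, zero_smul, sub_zero]
  rfl

theorem commute_etaBracket_etaTail (hij : j.castSucc = i.succ) :
    Commute (etaBracket i j) (etaTail j) := by
  have h0 := castSucc_ne_succ_of_eq hij
  refine Commute.add_left ?_ ?_
  · exact (commute_rowOp_xpow _ (fun e => (Fin.castSucc_lt_succ (i := j)).ne e.1) 1).symm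
  · exact commute_rowOp _ _ h0 (Fin.castSucc_lt_succ (i := j)).ne

theorem commute_etaBracket_xpow (hij : j.castSucc = i.succ) (c : ℂ) :
    Commute (etaBracket i j) (xpow j.succ j.castSucc c) :=
  Commute.add_left (commute_x_xpow ..)
    (commute_rowOp_xpow _ (fun e => castSucc_ne_succ_of_eq hij e.1) c)

theorem etaBracket_mem_good {f : Formal n} (hf : f ∈ good n) : etaBracket i j f ∈ good n :=
  Submodule.add_mem _ (x_mem_good _ _ hf) (rowOp_mem_good _ _ _ hf)

theorem etaBracket_mem_fil (hij : j.castSucc = i.succ) {M : ℕ} {f : Formal n} (hf : f ∈ fil j M) :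
    etaBracket i j f ∈ fil j (M + 1) := by
  refine Submodule.add_mem _ (x_mem_fil_succ j (castSucc_lt_of_eq hij) hf) ?_
  rw [rowOp, LinearMap.sum_apply]
  exact Submodule.sum_mem _ fun k hk => x_mul_pd_mem_fil_succ j
    ((Finset.mem_Iio.1 hk).trans (castSucc_lt_of_eq hij)) (castSucc_ne_succ_of_eq hij) hf

theorem etaBracket_pow_mem_fil (hij : j.castSucc = i.succ) (r : ℕ) {M : ℕ} {f : Formal n}
    (hf : f ∈ fil j M) : (etaBracket i j ^ r) f ∈ fil j (M + r) := by
  induction r with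
  | zero => exact hf
  | succ r ih =>
    rw [pow_succ', Module.End.mul_apply]
    exact etaBracket_mem_fil hij ih

/-- `η_i` involves only rows `i.castSucc` and `i.succ`, whereas `fil j` measures the degree in row
`j.succ`. -/
theorem eta_mem_fil_of_eq (hij : j.castSucc = i.succ) (a : ℂ) {M : ℕ} {f : Formal n}
    (hf : f ∈ fil j M) : eta i a f ∈ fil j M := fun α hα => by
  obtain ⟨p, hp⟩ := eta_apply_ne_zero hα
  suffices h : (etaTail i ^ p) f ∈ fil j M from
    Submodule.smul_mem (fil j M) _ (xpow_mem_fil j i _ h) α hp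
  clear hp
  induction p with
  | zero => exact hf
  | succ p ih =>
    rw [pow_succ', Module.End.mul_apply, etaTail, LinearMap.sum_apply]
    refine Submodule.sum_mem _ fun k _ => x_mul_pd_mem_fil j ?_ ?_ ih
    · rw [← hij]
      exact (Fin.castSucc_lt_succ (i := j)).ne
    · exact castSucc_ne_succ_of_eq hij

/-- A Leibniz rule: each factor `T_j` either passes through to `f`, or lowers the exponent of `η_i`
by one and produces one bracket. The induction is Pascal's rule. -/
theorem etaTail_pow_eta (hij : j.castSucc = i.succ) (m : ℂ) {f : Formal n} (hf : f ∈ good n)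
    (q : ℕ) : (etaTail j ^ q) (eta i m f) = ∑ z ∈ antidiagonal q, q.choose z.1 •
      ((descPochhammer ℂ z.1).eval m •
        eta i (m - z.1) ((etaBracket i j ^ z.1) ((etaTail j ^ z.2) f))) := by
  induction q with
  | zero => simp
  | succ q ih =>
    rw [Finset.sum_antidiagonal_choose_succ_nsmul (fun r s => (descPochhammer ℂ r).eval m •
      eta i (m - r) ((etaBracket i j ^ r) ((etaTail j ^ s) f))), pow_succ', Module.End.mul_apply,
      ih, map_sum, ← Finset.sum_add_distrib]
    refine Finset.sum_congr rfl fun z hz => ?_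
    have hg : (etaBracket i j ^ z.1) ((etaTail j ^ z.2) f) ∈ good n :=
      pow_mem_good (fun _ h => etaBracket_mem_good h) _ _
        (pow_mem_good (fun _ h => etaTail_mem_good j h) _ _ hf)
    have h1 : etaTail j ((etaBracket i j ^ z.1) ((etaTail j ^ z.2) f))
        = (etaBracket i j ^ z.1) ((etaTail j ^ (z.2 + 1)) f) := by
      rw [← Module.End.mul_apply, ← ((commute_etaBracket_etaTail hij).pow_left z.1).eq,
        Module.End.mul_apply, pow_succ', Module.End.mul_apply]
    have h2 : q.choose z.2 = q.choose z.1 := by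
      rw [← mem_antidiagonal.1 hz, Nat.choose_symm_add]
    rw [map_nsmul, map_smul, etaTail_eta hij _ hg, h1, smul_add, smul_add, h2, smul_smul,
      ← descPochhammer_succ_eval, ← Module.End.mul_apply (etaBracket i j), ← pow_succ']
    push_cast
    rw [sub_sub]

/-- `C(c, r+s) C(r+s, r) = C(c, r) C(c-r, s)` regroups the terms, for fixed `r`, into the series of
`η_j^{c-r}`. -/
theorem etaTerm_eta (hij : j.castSucc = i.succ) (c m : ℂ) {f : Formal n} (hf : f ∈ good n)
    (q : ℕ) : etaTerm j c q (eta i m f) = ∑ z ∈ antidiagonal q,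
      (Ring.choose c z.1 * (descPochhammer ℂ z.1).eval m) •
        eta i (m - z.1) ((etaBracket i j ^ z.1) (etaTerm j (c - z.1) z.2 f)) := by
  rw [etaTerm_eq, LinearMap.smul_apply, Module.End.mul_apply, etaTail_pow_eta hij m hf, map_sum,
    Finset.smul_sum]
  refine Finset.sum_congr rfl fun z hz => ?_
  have hg : (etaBracket i j ^ z.1) ((etaTail j ^ z.2) f) ∈ good n :=
    pow_mem_good (fun _ h => etaBracket_mem_good h) _ _
      (pow_mem_good (fun _ h => etaTail_mem_good j h) _ _ hf)
  have h1 : xpow j.succ j.castSucc (c - q)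
        (eta i (m - z.1) ((etaBracket i j ^ z.1) ((etaTail j ^ z.2) f)))
      = eta i (m - z.1) (xpow j.succ j.castSucc (c - q)
        ((etaBracket i j ^ z.1) ((etaTail j ^ z.2) f))) := by
    refine commute_eta (isLocal_xpow _ _ _) (fun _ h => xpow_mem_good j _ h)
      (fun _ => commute_xpow ..) ?_ _ hg
    exact (commute_rowOp_xpow _ (fun e => castSucc_ne_succ_of_eq hij e.1) _).symm
  have h2 := LinearMap.congr_fun
    ((commute_etaBracket_xpow hij (c - q)).pow_left z.1).eq ((etaTail j ^ z.2) f)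
  simp only [Module.End.mul_apply] at h2
  have h3 : c - z.1 - z.2 = c - q := by
    rw [← mem_antidiagonal.1 hz]; push_cast; ring
  have h4 := choose_add_mul_choose c z.1 z.2
  rw [mem_antidiagonal.1 hz] at h4
  rw [etaTerm_eq, map_nsmul, map_smul, h1, ← h2, LinearMap.smul_apply, map_smul, map_smul,
    Module.End.mul_apply, h3, smul_smul, ← Nat.cast_smul_eq_nsmul ℂ, smul_smul, smul_smul,
    h4]
  congr 1
  ring

/-- Reordering formula with `η_i` on the left, brackets in the middle and `η_j` on the right. Each
bracket and each `T_j` raises the degree of `fil j` by one, so for a given coefficient the double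
series in `r`, `s` is finite. -/
theorem conv_eta_eta (hij : j.castSucc = i.succ) (c m : ℂ) {f : Formal n} (hf : f ∈ good n) :
    Conv (fun N => ∑ r ∈ Finset.range N, (Ring.choose c r * (descPochhammer ℂ r).eval m) •
        eta i (m - r) ((etaBracket i j ^ r) (eta j (c - r) f)))
      (eta j c (eta i m f)) := fun α => by
  have h0 : f ∈ fil j 0 := by rwa [fil_zero]
  filter_upwards [eventually_ge_atTop (cut j α)] with N hN
  set F : ℕ → ℕ → Formal n := fun r s => (Ring.choose c r * (descPochhammer ℂ r).eval m) •
        eta i (m - r) ((etaBracket i j ^ r) (etaTerm j (c - r) s f)) with hF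
  have h1 : eta j c (eta i m f) α
      = ∑ q ∈ Finset.range N, ∑ z ∈ antidiagonal q, F z.1 z.2 α := by
    rw [eta_apply_eq_sum c (eta_mem_good i m hf) hN]
    refine Finset.sum_congr rfl fun q _ => ?_
    rw [etaTerm_eta hij c m hf, Finset.sum_apply]
  rw [h1, sum_antidiagonal_eq_sum_square N (fun r s => F r s α), Finset.sum_apply]
  · refine Finset.sum_congr rfl fun r _ => ?_
    have := eq_zero_of_mem_fil (eta_mem_fil_of_eq hij (m - r) (etaBracket_pow_mem_fil hij r
      (eta_sub_sum_mem_fil j (c - r) hf N))) (le_add_right hN)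
    rw [map_sub, map_sub, Pi.sub_apply, sub_eq_zero, map_sum, map_sum, Finset.sum_apply] at this
    simp only [hF, Pi.smul_apply]
    rw [this, Finset.smul_sum]
  · intro r s hrs
    exact eq_zero_of_mem_fil (Submodule.smul_mem _ _ (eta_mem_fil_of_eq hij _
      (etaBracket_pow_mem_fil hij r (etaTerm_mem_fil j _ s h0)))) (by omega)

/-- **Verma's identity** for complex powers. -/
theorem eta_braid (hij : j.castSucc = i.succ) (k m : ℂ) {f : Formal n} (hf : f ∈ good n) :
    eta i k (eta j (k + m) (eta i m f)) = eta j m (eta i (k + m) (eta j k f)) := by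
  refine ((isLocal_eta i k _ _ (conv_eta_eta hij (k + m) m hf)).congr fun N => ?_).unique
    (conv_eta_eta hij m (k + m) (eta_mem_good j k hf))
  rw [map_sum]
  refine Finset.sum_congr rfl fun r _ => ?_
  have hg : (etaBracket i j ^ r) (eta j (k + m - r) f) ∈ good n :=
    pow_mem_good (fun _ h => etaBracket_mem_good h) _ _ (eta_mem_good j _ hf)
  -- Merging adjacent powers leaves `η_i^{k+m-r} B^r η_j^{k+m-r}` on both sides, with coefficient
  -- `r! C(k+m, r) C(m, r)`, symmetric in `k + m` and `m`.
  rw [map_smul, eta_eta i _ _ hg, eta_eta j _ _ hf, descPochhammer_eval_eq, descPochhammer_eval_eq]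
  congr 1
  · ring
  · rw [show k + (m - r) = k + m - r by ring, show m - r + k = k + m - r by ring]

theorem eta_comm (h : j.castSucc ≠ i.succ) (h' : i.castSucc ≠ j.succ) (a b : ℂ) {f : Formal n}
    (hf : f ∈ good n) : eta i a (eta j b f) = eta j b (eta i a f) := by
  refine (conv_eta i a (eta_mem_good j b hf)).unique
    ((isLocal_eta j b _ _ (conv_eta i a hf)).congr fun N => ?_)
  rw [map_sum]
  refine Finset.sum_congr rfl fun p _ => (commute_eta (isLocal_etaTerm i a p)
    (fun _ hg => etaTerm_mem_good i a p hg) (fun c => ?_) ?_ b hf).symm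
  · rw [etaTerm_eq]
    exact ((commute_xpow ..).mul_left
      ((commute_rowOp_xpow _ (fun e => h' e.1) c).pow_left p)).smul_left _
  · rw [etaTerm_eq]
    exact ((commute_rowOp_xpow _ (fun e => h e.1) _).symm.mul_left
      ((commute_rowOp _ _ h' h).pow_left p)).smul_left _

end Verma

end

end VermaSing

namespace VermaSing

noncomputable section

/-! ### The operators `d_i` and the powers `η_j^a` -/

section Singular

variable {n : ℕ}

/-- The operator `∑_{k ∈ s} x_{k,a} ∂_{k,b}`. -/
def colOp (s : Finset (Fin (n + 1))) (a b : Fin (n + 1)) : Module.End ℂ (Formal n) :=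
  ∑ k ∈ s, x k a * pd k b

theorem isLocal_colOp (s : Finset (Fin (n + 1))) (a b : Fin (n + 1)) :
    IsLocal (colOp (n := n) s a b) :=
  IsLocal.sum _ fun _ _ => IsLocal.mul (isLocal_x _ _) (isLocal_pd _ _)

theorem colOp_mem_good (s : Finset (Fin (n + 1))) (a b : Fin (n + 1)) {f : Formal n}
    (hf : f ∈ good n) : colOp s a b f ∈ good n := by
  rw [colOp, LinearMap.sum_apply]
  exact Submodule.sum_mem _ fun k _ => x_mem_good _ _ (pd_mem_good _ _ hf)

theorem commute_colOp_xpow (s : Finset (Fin (n + 1))) {a b p q : Fin (n + 1)}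
    (h : ¬(p ∈ s ∧ b = q)) (c : ℂ) : Commute (colOp (n := n) s a b) (xpow p q c) :=
  Commute.sum_left _ _ _ fun k hk => Commute.mul_left (commute_x_xpow ..)
    (commute_pd_xpow (by rintro ⟨rfl, rfl⟩; exact h ⟨hk, rfl⟩) c)

/-- Both possible commutator terms are `x_{c,a} ∂_{d,b}`, with opposite signs. The hypothesis says
that the index ranges produce both or neither. -/
theorem commute_colOp_rowOp (s t : Finset (Fin (n + 1))) {a b c d : Fin (n + 1)}
    (h : (c ∈ s ∧ b ∈ t) ↔ (d ∈ s ∧ a ∈ t)) :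
    Commute (colOp (n := n) s a b) (rowOp t c d) := by
  rw [Commute, SemiconjBy, colOp, rowOp, Finset.sum_mul_sum, Finset.sum_mul_sum,
    Finset.sum_congr rfl fun k _ => Finset.sum_congr rfl fun l _ => xpd_mul_xpd k a k b c l d l]
  simp only [Finset.sum_sub_distrib, Finset.sum_add_distrib, ite_and, Finset.sum_ite_irrel,
    Finset.sum_const_zero, Finset.sum_ite_eq, Finset.sum_ite_eq']
  rw [Finset.sum_comm, add_sub_assoc, add_eq_left, sub_eq_zero]
  by_cases h1 : c ∈ s <;> by_cases h2 : b ∈ t <;> by_cases h3 : d ∈ s <;> by_cases h4 : a ∈ t <;>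
    simp_all

theorem colOp_mul_xpow_self (s : Finset (Fin (n + 1))) {p : Fin (n + 1)} (hp : p ∈ s)
    (a : Fin (n + 1)) (c : ℂ) :
    colOp (n := n) s a a * xpow p a c = xpow p a c * colOp s a a + c • xpow p a c := by
  have h : ∀ k ∈ s, (x (n := n) k a * pd k a) * xpow p a c
      = xpow p a c * (x k a * pd k a) + if k = p then c • xpow p a c else 0 := fun k _ => by
    split_ifs with hk
    · subst hk
      rw [mul_assoc, pd_mul_xpow_self, mul_add, ← mul_assoc, (commute_x_xpow ..).eq, mul_assoc,
        mul_smul_comm, x, xpow_mul_xpow, add_sub_cancel]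
    · rw [mul_assoc, (commute_pd_xpow (fun e => hk e.1) c).eq, ← mul_assoc, (commute_x_xpow ..).eq,
        mul_assoc, add_zero]
  rw [colOp, Finset.sum_mul, Finset.sum_congr rfl h, Finset.sum_add_distrib, Finset.mul_sum]
  simp [hp]

theorem rowOp_mul_rowOp_swap (s : Finset (Fin (n + 1))) (a b : Fin (n + 1)) :
    rowOp (n := n) s a b * rowOp s b a
      = rowOp s b a * rowOp s a b + (rowOp s a a - rowOp s b b) := by
  simp only [rowOp, Finset.sum_mul_sum]
  rw [Finset.sum_congr rfl fun k _ => Finset.sum_congr rfl fun l _ => xpd_mul_xpd a k b k b l a l]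
  simp only [true_and, Finset.sum_sub_distrib, Finset.sum_add_distrib, Finset.sum_ite_eq,
    Finset.sum_ite_eq']
  rw [Finset.sum_comm, add_sub_assoc]
  congr 2 <;> exact Finset.sum_congr rfl fun k hk => by simp [hk]

theorem Ioi_castSucc_eq (i : Fin n) :
    Finset.Ioi i.castSucc = insert i.succ (Finset.Ioi i.succ) := by
  ext k
  simp only [Finset.mem_Ioi, Finset.mem_insert, Fin.lt_def, Fin.ext_iff, Fin.val_succ,
    Fin.val_castSucc]
  omega

/-- The part of `ζ_i` that involves the rows below `i + 1`, and the constant. -/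
def lowerWeight (lam : Fin n → ℂ) (i : Fin n) : Module.End ℂ (Formal n) :=
  lam i • 1 - colOp (Finset.Ioi i.succ) i.castSucc i.castSucc
    + colOp (Finset.Ioi i.succ) i.succ i.succ

/-- The part of `ζ_i` that involves the columns before `i`. -/
def upperWeight (i : Fin n) : Module.End ℂ (Formal n) :=
  rowOp (Finset.Iio i.castSucc) i.castSucc i.castSucc
    - rowOp (Finset.Iio i.castSucc) i.succ i.succ

theorem d_eq (lam : Fin n → ℂ) (i : Fin n) :
    d lam i = (lowerWeight lam i - x i.succ i.castSucc * pd i.succ i.castSucc)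
        * pd i.succ i.castSucc
      + rowOp (Finset.Iio i.castSucc) i.castSucc i.succ
      - colOp (Finset.Ioi i.succ) i.succ i.castSucc := by
  rw [d, lowerWeight, Ioi_castSucc_eq, Finset.sum_insert (by simp)]
  simp only [rowOp, colOp]
  congr 3
  abel

theorem zeta_eq (lam : Fin n → ℂ) (i : Fin n) :
    zeta lam i = (lowerWeight lam i - (2 : ℂ) • (x i.succ i.castSucc * pd i.succ i.castSucc))
      + upperWeight i := by
  simp only [zeta, lowerWeight, upperWeight, rowOp, colOp, Finset.sum_sub_distrib]
  abel

theorem isLocal_d (lam : Fin n → ℂ) (i : Fin n) : IsLocal (d lam i) := by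
  rw [d]
  exact IsLocal.sub (IsLocal.add (IsLocal.mul (IsLocal.add (IsLocal.sub (IsLocal.smul _ IsLocal.one)
    (isLocal_colOp _ _ _)) (isLocal_colOp _ _ _)) (isLocal_pd _ _)) (isLocal_rowOp _ _ _))
    (isLocal_colOp _ _ _)

theorem lowerWeight_mem_good (lam : Fin n → ℂ) (i : Fin n) {f : Formal n} (hf : f ∈ good n) :
    lowerWeight lam i f ∈ good n :=
  Submodule.add_mem _ (Submodule.sub_mem _ (Submodule.smul_mem _ _ hf) (colOp_mem_good _ _ _ hf))
    (colOp_mem_good _ _ _ hf)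

theorem d_mem_good (lam : Fin n → ℂ) (i : Fin n) {f : Formal n} (hf : f ∈ good n) :
    d lam i f ∈ good n := by
  have h := pd_mem_good i.succ i.castSucc hf
  rw [d_eq]
  exact Submodule.sub_mem _ (Submodule.add_mem _ (Submodule.sub_mem _ (lowerWeight_mem_good lam i h)
    (x_mem_good _ _ (pd_mem_good _ _ h))) (rowOp_mem_good _ _ _ hf)) (colOp_mem_good _ _ _ hf)

theorem commute_lowerWeight_xpow (lam : Fin n → ℂ) (i : Fin n) (c : ℂ) :
    Commute (lowerWeight lam i) (xpow i.succ i.castSucc c) :=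
  (((Commute.one_left _).smul_left _).sub_left (commute_colOp_xpow _ (by simp) c)).add_left
    (commute_colOp_xpow _ (by simp) c)

theorem commute_lowerWeight_etaTail (lam : Fin n → ℂ) (i : Fin n) :
    Commute (lowerWeight lam i) (etaTail i) := by
  have h : ¬ i.succ < i.castSucc := (Fin.castSucc_lt_succ (i := i)).le.not_gt
  exact (((Commute.one_left _).smul_left _).sub_left (commute_colOp_rowOp _ _ (by simp))).add_left
    (commute_colOp_rowOp _ _ (by simp [h]))

theorem commute_pd_etaTail (i : Fin n) : Commute (pd i.succ i.castSucc) (etaTail i) :=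
  Commute.sum_right _ _ _ fun _ hk => Commute.mul_right
    (commute_pd_x (fun e => (Finset.mem_Iio.1 hk).ne e.2.symm)) (commute_pd ..)

/-- Here `Z + W` is `ζ_i`. The second-order part `-x ∂²` of `d_i` in the variable `x_{i+1,i}` forces
`κ = 1`, matched by the `sl_2` relation between `W` and the tail. -/
theorem derives_d (lam : Fin n → ℂ) (i : Fin n) :
    Derives i 1 (d lam i)
      (lowerWeight lam i - (2 : ℂ) • (x i.succ i.castSucc * pd i.succ i.castSucc))
      (upperWeight i) where
  isLocal := isLocal_d lam i
  mem_good _ hf := d_mem_good lam i hf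
  mem_good_Z f hf := Submodule.sub_mem _ (lowerWeight_mem_good lam i hf)
    (Submodule.smul_mem _ _ (x_mem_good _ _ (pd_mem_good _ _ hf)))
  mem_good_W f hf := Submodule.sub_mem _ (rowOp_mem_good _ _ _ hf) (rowOp_mem_good _ _ _ hf)
  mul_xpow c := by
    have hL := fun c => (commute_lowerWeight_xpow lam i c).eq
    have hG := (commute_rowOp_xpow (Finset.Iio i.castSucc) (a := i.castSucc) (b := i.succ)
      (p := i.succ) (q := i.castSucc) (by simp) c).eq
    have hH := (commute_colOp_xpow (Finset.Ioi i.succ) (a := i.succ) (b := i.castSucc)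
      (p := i.succ) (q := i.castSucc) (by simp) c).eq
    have hD := fun c => pd_mul_xpow_self i.succ i.castSucc c
    have hx := fun c => (commute_x_xpow i.succ i.castSucc i.succ i.castSucc c).eq
    have hxx : x i.succ i.castSucc * xpow i.succ i.castSucc (c - 1 - 1)
        = xpow i.succ i.castSucc (c - 1) := by
      rw [x, xpow_mul_xpow]; congr 1; ring
    rw [d_eq]
    set X := xpow i.succ i.castSucc c
    set L := lowerWeight lam i
    set D := pd i.succ i.castSucc
    set Y := x i.succ i.castSucc
    have h1 : (L - Y * D) * D * X = X * ((L - Y * D) * D)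
        + c • (xpow i.succ i.castSucc (c - 1) * (L - (2 : ℂ) • (Y * D) - (c - 1) • 1)) := by
      have e1 : Y * D * X = X * (Y * D) + c • (xpow i.succ i.castSucc (c - 1) * Y) := by
        rw [mul_assoc, hD, mul_add, ← mul_assoc, hx, mul_assoc, mul_smul_comm, hx]
      have e2 : Y * D * xpow i.succ i.castSucc (c - 1)
          = xpow i.succ i.castSucc (c - 1) * (Y * D)
            + (c - 1) • xpow i.succ i.castSucc (c - 1) := by
        rw [mul_assoc, hD, mul_add, ← mul_assoc, hx, mul_assoc, mul_smul_comm, hxx]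
      rw [mul_assoc, hD, mul_add, ← mul_assoc, sub_mul, hL, e1, mul_smul_comm, sub_mul L, hL, e2]
      simp only [mul_sub, sub_mul, add_mul, mul_assoc, smul_mul_assoc, mul_smul_comm, mul_one,
        smul_sub, smul_add]
      module
    rw [sub_mul, add_mul, h1, hG, hH, mul_one, mul_sub X, mul_add X]
    abel
  mul_tail := by
    have hL := (commute_lowerWeight_etaTail lam i)
    have hD := commute_pd_etaTail i
    have hx : Commute (x i.succ i.castSucc) (etaTail i) :=
      (commute_etaTail_xpow i 1).symm
    have hH : Commute (colOp (Finset.Ioi i.succ) i.succ i.castSucc) (etaTail i) :=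
      commute_colOp_rowOp _ _ (by simp [(Fin.castSucc_lt_succ (i := i)).le])
    have hG := rowOp_mul_rowOp_swap (Finset.Iio i.castSucc) i.castSucc i.succ
    rw [d_eq, sub_mul, add_mul, ((hL.sub_left (hx.mul_left hD)).mul_left hD).eq, hH.eq,
      etaTail_eq_rowOp, hG, upperWeight, mul_sub, mul_add]
    abel
  Z_mul_tail := (commute_lowerWeight_etaTail lam i).sub_left
    ((Commute.mul_left (commute_etaTail_xpow i 1).symm (commute_pd_etaTail i)).smul_left _)
  W_mul_tail := by
    have h := (Fin.castSucc_lt_succ (i := i)).ne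
    have h1 := rowOp_mul_rowOp (n := n) (Finset.Iio i.castSucc) (a := i.succ) (b := i.succ)
      (c := i.castSucc) h
    have h2 := rowOp_mul_rowOp (n := n) (Finset.Iio i.castSucc) (a := i.succ) (b := i.castSucc)
      (c := i.castSucc) h
    rw [upperWeight, etaTail_eq_rowOp, sub_mul, h1, mul_sub, h2]
    module

theorem d_eta_self (lam : Fin n → ℂ) (i : Fin n) (a : ℂ) {f : Formal n} (hf : f ∈ good n) :
    d lam i (eta i a f)
      = eta i a (d lam i f) + a • eta i (a - 1) (zeta lam i f - (a - 1) • f) := by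
  rw [(derives_d lam i).apply_eta a hf, mul_one, zeta_eq]
  rfl

variable {i j : Fin n}

/-- The only neighbour for which `d_i` fails to commute with the two parts of `η_j` separately. The
defects are opposite, so `Z + W = 0` and `η_j^a` still commutes with `d_i`. -/
theorem derives_d_of_eq (lam : Fin n → ℂ) (hij : j.castSucc = i.succ) :
    Derives j 0 (d lam i) (x j.succ j.castSucc * pd i.succ i.castSucc)
      (-(x j.succ j.castSucc * pd i.succ i.castSucc)) := by
  have hlt := Fin.castSucc_lt_succ (i := i)
  have hlt' : i.succ < j.succ := hij ▸ Fin.castSucc_lt_succ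
  have hYT : Commute (x j.succ j.castSucc * pd i.succ i.castSucc) (etaTail j) :=
    Commute.sum_right _ _ _ fun k hk => commute_xpd (fun e => hlt'.ne e.1)
      (fun e => (Finset.mem_Iio.1 hk).ne e.2)
  have hg : ∀ f ∈ good n, (x j.succ j.castSucc * pd i.succ i.castSucc) f ∈ good n :=
    fun f hf => x_mem_good _ _ (pd_mem_good _ _ hf)
  refine
    { isLocal := isLocal_d lam i
      mem_good := fun _ hf => d_mem_good lam i hf
      mem_good_Z := hg
      mem_good_W := fun f hf => Submodule.neg_mem _ (hg f hf)
      mul_xpow := fun c => ?_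
      mul_tail := ?_
      Z_mul_tail := hYT
      W_mul_tail := by rw [hYT.neg_left.eq, mul_zero, zero_smul, sub_zero] }
  · have hP : Commute (colOp (Finset.Ioi i.succ) i.castSucc i.castSucc)
        (xpow j.succ j.castSucc c) := commute_colOp_xpow _ (fun e => hlt.ne (e.2.trans hij)) c
    have hH : Commute (colOp (Finset.Ioi i.succ) i.succ i.castSucc)
        (xpow j.succ j.castSucc c) := commute_colOp_xpow _ (fun e => hlt.ne (e.2.trans hij)) c
    have hG : Commute (rowOp (Finset.Iio i.castSucc) i.castSucc i.succ)
        (xpow j.succ j.castSucc c) := commute_rowOp_xpow _ (fun e => hlt'.ne e.1) c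
    have hD : Commute (pd i.succ i.castSucc) (xpow j.succ j.castSucc c) :=
      commute_pd_xpow (fun e => hlt'.ne e.1) c
    have hx : Commute (x i.succ i.castSucc) (xpow j.succ j.castSucc c) := commute_x_xpow ..
    have hQ := colOp_mul_xpow_self (Finset.Ioi i.succ) (Finset.mem_Ioi.2 hlt') j.castSucc c
    have hY : xpow j.succ j.castSucc (c - 1) * x j.succ j.castSucc = xpow j.succ j.castSucc c := by
      rw [x, xpow_mul_xpow, sub_add_cancel]
    have hL : lowerWeight lam i * xpow j.succ j.castSucc c
        = xpow j.succ j.castSucc c * lowerWeight lam i + c • xpow j.succ j.castSucc c := by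
      rw [hij] at hQ hP ⊢
      rw [lowerWeight, add_mul, sub_mul, hP.eq, hQ, mul_add, mul_sub, smul_mul_assoc,
        mul_smul_comm, one_mul, mul_one]
      abel
    rw [d_eq, sub_mul, add_mul, mul_assoc _ (pd _ _), hD.eq, ← mul_assoc, sub_mul, hL,
      (hx.mul_left hD).eq, hG.eq, hH.eq, mul_zero, zero_smul, sub_zero,
      ← mul_assoc _ (x j.succ j.castSucc), hY]
    simp only [mul_sub, mul_add, sub_mul, add_mul, smul_mul_assoc, mul_assoc]
    abel
  · have hG : Commute (rowOp (Finset.Iio i.castSucc) i.castSucc i.succ) (etaTail j) :=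
      commute_rowOp _ _ hlt'.ne (hij.trans_ne hlt.ne')
    have hlow : Commute (lowerWeight lam i - x i.succ i.castSucc * pd i.succ i.castSucc)
        (etaTail j) := by
      have hIoi : lowerWeight lam i - x i.succ i.castSucc * pd i.succ i.castSucc
          = lam i • 1 - colOp (Finset.Ioi i.castSucc) i.castSucc i.castSucc
            + colOp (Finset.Ioi i.succ) i.succ i.succ := by
        rw [lowerWeight, Ioi_castSucc_eq, colOp, colOp, colOp, Finset.sum_insert (by simp)]
        abel
      rw [hIoi, etaTail_eq_rowOp, hij]
      exact (((Commute.one_left _).smul_left _).sub_left (commute_colOp_rowOp _ _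
        (by simp [hlt, hlt.trans hlt']))).add_left (commute_colOp_rowOp _ _ (by simp))
    have hD : Commute (pd i.succ i.castSucc) (etaTail j) :=
      Commute.sum_right _ _ _ fun k _ => Commute.mul_right
        (commute_pd_x (fun e => hlt'.ne e.1)) (commute_pd ..)
    have hH : colOp (Finset.Ioi i.succ) i.succ i.castSucc * etaTail j
        = etaTail j * colOp (Finset.Ioi i.succ) i.succ i.castSucc
          + x j.succ j.castSucc * pd i.succ i.castSucc := by
      have h1 : Commute (colOp (Finset.Ioi i.succ) i.succ i.castSucc)
          (rowOp (Finset.Iio i.castSucc) j.succ i.succ) :=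
        commute_colOp_rowOp _ _ (by simp)
      have h2 : colOp (Finset.Ioi i.succ) i.succ i.castSucc * x j.succ i.castSucc
          = x j.succ i.castSucc * colOp (Finset.Ioi i.succ) i.succ i.castSucc
            + x j.succ i.succ := by
        have h : ∀ k ∈ Finset.Ioi i.succ, (x k i.succ * pd k i.castSucc) * x j.succ i.castSucc
            = x j.succ i.castSucc * (x k i.succ * pd k i.castSucc)
              + if k = j.succ then x (n := n) k i.succ else 0 := fun k _ => by
          rw [mul_assoc, pd_mul_x, mul_add, ← mul_assoc, (commute_x ..).eq, mul_assoc]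
          simp
        rw [colOp, Finset.sum_mul, Finset.sum_congr rfl h, Finset.sum_add_distrib, Finset.mul_sum]
        simp [hlt']
      have h3 : Commute (colOp (Finset.Ioi i.succ) i.succ i.castSucc) (pd i.succ i.castSucc) :=
        Commute.sum_left _ _ _ fun k hk => Commute.mul_left
          (commute_pd_x (fun e => hlt.ne e.2)).symm (commute_pd ..)
      rw [etaTail_eq_add hij, mul_add, h1.eq, ← mul_assoc, h2, add_mul, mul_assoc, h3.eq, hij,
        add_mul, mul_assoc]
      abel
    rw [d_eq, sub_mul, add_mul, (hlow.mul_left hD).eq, hG.eq, hH, mul_sub, mul_add]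
    abel

theorem d_eta_of_ne (lam : Fin n → ℂ) (hij : j ≠ i) (a : ℂ) {f : Formal n} (hf : f ∈ good n) :
    d lam i (eta j a f) = eta j a (d lam i f) := by
  by_cases h : j.castSucc = i.succ
  · rw [(derives_d_of_eq lam h).apply_eta a hf]
    simp
  have h1 : (j : ℕ) ≠ i := fun e => hij (Fin.ext e)
  have h2 : (j : ℕ) ≠ i + 1 := fun e => h (Fin.ext (by simpa using e))
  refine commute_eta (isLocal_d lam i) (fun _ h => d_mem_good lam i h) (fun c => ?_) ?_ a hf
  · have hD : Commute (pd i.succ i.castSucc) (xpow j.succ j.castSucc c) :=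
      commute_pd_xpow (by simp [Fin.ext_iff]; omega) c
    have hP : Commute (colOp (Finset.Ioi i.castSucc) i.castSucc i.castSucc)
      (xpow j.succ j.castSucc c) := commute_colOp_xpow _ (by simp [Fin.ext_iff]; omega) c
    have hQ : Commute (colOp (Finset.Ioi i.succ) i.succ i.succ)
      (xpow j.succ j.castSucc c) := commute_colOp_xpow _ (by simp [Fin.ext_iff]; omega) c
    have hG : Commute (rowOp (Finset.Iio i.castSucc) i.castSucc i.succ)
      (xpow j.succ j.castSucc c) := commute_rowOp_xpow _ (by simp [Fin.ext_iff]; omega) c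
    have hH : Commute (colOp (Finset.Ioi i.succ) i.succ i.castSucc)
      (xpow j.succ j.castSucc c) := commute_colOp_xpow _ (by simp [Fin.ext_iff]; omega) c
    exact ((((((Commute.one_left _).smul_left _).sub_left hP).add_left hQ).mul_left hD).add_left
      hG).sub_left hH
  · have hD : Commute (pd i.succ i.castSucc) (etaTail j) :=
      Commute.sum_right _ _ _ fun k _ => Commute.mul_right
        (commute_pd_x (by simp [Fin.ext_iff]; omega)) (commute_pd ..)
    have hP : Commute (colOp (Finset.Ioi i.castSucc) i.castSucc i.castSucc) (etaTail j) :=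
      commute_colOp_rowOp _ _ (by
        simp only [Finset.mem_Ioi, Finset.mem_Iio, Fin.lt_def, Fin.val_succ, Fin.val_castSucc]; omega)
    have hQ : Commute (colOp (Finset.Ioi i.succ) i.succ i.succ) (etaTail j) :=
      commute_colOp_rowOp _ _ (by
        simp only [Finset.mem_Ioi, Finset.mem_Iio, Fin.lt_def, Fin.val_succ, Fin.val_castSucc]; omega)
    have hG : Commute (rowOp (Finset.Iio i.castSucc) i.castSucc i.succ) (etaTail j) :=
      commute_rowOp _ _ (by simp [Fin.ext_iff]; omega) (by simp [Fin.ext_iff]; omega)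
    have hH : Commute (colOp (Finset.Ioi i.succ) i.succ i.castSucc) (etaTail j) :=
      commute_colOp_rowOp _ _ (by
        simp only [Finset.mem_Ioi, Finset.mem_Iio, Fin.lt_def, Fin.val_succ, Fin.val_castSucc]; omega)
    exact ((((((Commute.one_left _).smul_left _).sub_left hP).add_left hQ).mul_left hD).add_left
      hG).sub_left hH

/-- `η_i^{μ_i+1}` maps singular vectors of weight `μ` to singular vectors. -/
theorem d_eta_eq_zero {lam μ : Fin n → ℂ} {f : Formal n} (hf : f ∈ good n)
    (hw : HasWeight lam μ f) (hd : ∀ k, d lam k f = 0) (i k : Fin n) :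
    d lam k (eta i (μ i + 1) f) = 0 := by
  by_cases h : i = k
  · subst h
    rw [d_eta_self lam i _ hf, hd, hw i]
    simp
  · rw [d_eta_of_ne lam h _ hf, hd, map_zero]

end Singular

end

end VermaSing

namespace VermaSing

/-! ### The Coxeter presentation of the symmetric group -/

section Coxeter

variable {M : Type*} [Monoid M]

/-- The ordered product `g k * g (k + 1) * ⋯ * g (k + m - 1)`. -/
def chain (g : ℕ → M) : ℕ → ℕ → M
  | _, 0 => 1
  | k, m + 1 => g k * chain g (k + 1) m

/-- The Coxeter relations of type `A_n` for `g 0, …, g (n - 1)`. -/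
structure CoxeterRel (n : ℕ) (g : ℕ → M) : Prop where
  sq : ∀ i < n, g i * g i = 1
  braid : ∀ i, i + 1 < n → g i * g (i + 1) * g i = g (i + 1) * g i * g (i + 1)
  comm : ∀ i j, i + 1 < j → j < n → Commute (g i) (g j)

theorem CoxeterRel.mono {m n : ℕ} {g : ℕ → M} (h : CoxeterRel n g) (hmn : m ≤ n) :
    CoxeterRel m g where
  sq i hi := h.sq i (hi.trans_le hmn)
  braid i hi := h.braid i (hi.trans_le hmn)
  comm i j hij hj := h.comm i j hij (hj.trans_le hmn)

theorem CoxeterRel.commute_chain {n : ℕ} {g : ℕ → M} (h : CoxeterRel n g) {i k m : ℕ}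
    (hik : i + 1 < k) (hkm : k + m ≤ n) : Commute (g i) (chain g k m) := by
  induction m generalizing k with
  | zero => exact Commute.one_right _
  | succ m ih =>
    exact (h.comm i k hik (by omega)).mul_right (ih (by omega) (by omega))

/-- `g (i + 1)` slides past the factors before `g i`, the braid relation on `g i * g (i + 1)` turns
it into `g i`, and that slides past the rest. -/
theorem CoxeterRel.mul_chain {n : ℕ} {g : ℕ → M} (h : CoxeterRel n g) {i k m : ℕ}
    (hki : k < i + 1) (him : i + 1 < k + m) (hkm : k + m ≤ n) :
    g (i + 1) * chain g k m = chain g k m * g i := by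
  induction m generalizing k with
  | zero => omega
  | succ m ih =>
    rcases eq_or_ne i k with rfl | hne
    · rcases m with _ | m
      · omega
      · simp only [chain]
        rw [← mul_assoc, ← mul_assoc, ← h.braid i (by omega), mul_assoc,
          (h.commute_chain (by omega) (by omega)).eq]
        simp only [mul_assoc]
    · simp only [chain]
      rw [← mul_assoc, ← (h.comm k (i + 1) (by omega) (by omega)).eq, mul_assoc,
        ih (by omega) (by omega) (by omega), mul_assoc]

/-- Coset decomposition. Left multiplication by `g i` passes through the chain if `i + 1 < k`,
lengthens it if `i + 1 = k`, cancels its head if `i = k`, and becomes `g (i - 1)` on the right if `i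
> k`. -/
theorem CoxeterRel.exists_chain_mul {n : ℕ} {g : ℕ → M} (h : CoxeterRel (n + 1) g) {w : M}
    (hw : w ∈ Submonoid.closure (g '' Set.Iio (n + 1))) :
    ∃ k ≤ n + 1, ∃ v ∈ Submonoid.closure (g '' Set.Iio n), w = chain g k (n + 1 - k) * v := by
  induction hw using Submonoid.closure_induction_left with
  | one => exact ⟨n + 1, le_rfl, 1, one_mem _, by simp [chain]⟩
  | mul_left y hy w _ ih =>
    obtain ⟨i, hi, rfl⟩ := hy
    obtain ⟨k, hk, v, hv, rfl⟩ := ih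
    have hi : i < n + 1 := hi
    have mem : ∀ l < n, g l * v ∈ Submonoid.closure (g '' Set.Iio n) := fun l hl =>
      mul_mem (Submonoid.subset_closure ⟨l, hl, rfl⟩) hv
    rcases lt_trichotomy i k with hik | rfl | hik
    · rcases (Nat.succ_le_of_lt hik).lt_or_eq with hik | rfl
      · refine ⟨k, hk, g i * v, mem i (by omega), ?_⟩
        rw [← mul_assoc, (h.commute_chain hik (by omega)).eq, mul_assoc]
      · refine ⟨i, by omega, v, hv, ?_⟩
        rw [show n + 1 - i = (n + 1 - i.succ) + 1 by omega, chain, mul_assoc]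
    · refine ⟨i + 1, by omega, v, hv, ?_⟩
      rw [show n + 1 - i = (n + 1 - (i + 1)) + 1 by omega, chain, ← mul_assoc, ← mul_assoc,
        h.sq i hi, one_mul]
    · obtain ⟨l, rfl⟩ : ∃ l, i = l + 1 := ⟨i - 1, by omega⟩
      refine ⟨k, hk, g l * v, mem l (by omega), ?_⟩
      rw [← mul_assoc, h.mul_chain hik (by omega) (by omega), mul_assoc]

/-- The `n + 2` possible chains supply the new factor of the factorial. -/
theorem CoxeterRel.encard_closure_le {n : ℕ} {g : ℕ → M} (h : CoxeterRel n g) :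
    (Submonoid.closure (g '' Set.Iio n) : Set M).encard ≤ (n + 1).factorial := by
  induction n with
  | zero => simp
  | succ n ih =>
    have hsub : (Submonoid.closure (g '' Set.Iio (n + 1)) : Set M) ⊆
        ⋃ k ∈ Finset.range (n + 2), (chain g k (n + 1 - k) * ·) ''
          (Submonoid.closure (g '' Set.Iio n) : Set M) := fun w hw => by
      obtain ⟨k, hk, v, hv, rfl⟩ := h.exists_chain_mul hw
      exact Set.mem_biUnion (Finset.mem_coe.2 (Finset.mem_range.2 (by omega))) ⟨v, hv, rfl⟩
    refine (Set.encard_le_encard hsub).trans ((Finset.set_encard_biUnion_le _ _).trans ?_)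
    refine (Finset.sum_le_card_nsmul _ _ ((n + 1).factorial : ℕ∞) fun k _ =>
      (Set.encard_image_le _ _).trans (ih (h.mono n.le_succ))).trans ?_
    rw [Finset.card_range, Nat.factorial_succ (n + 1), nsmul_eq_mul]
    push_cast
    rfl

theorem swap_braid {α : Type*} [DecidableEq α] {a b c : α} (hab : a ≠ b) (hac : a ≠ c)
    (hbc : b ≠ c) : Equiv.swap a b * Equiv.swap b c * Equiv.swap a b
      = Equiv.swap b c * Equiv.swap a b * Equiv.swap b c := by
  rw [Equiv.swap_mul_swap_mul_swap hab hac, Equiv.swap_comm a b, Equiv.swap_comm b c,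
    Equiv.swap_mul_swap_mul_swap hbc.symm hac.symm, Equiv.swap_comm]

/-- The symmetric group is presented by the adjacent transpositions and the Coxeter relations. -/
theorem exists_monoidHom_of_coxeterRel {n : ℕ} (s : Fin n → M) (sq : ∀ i, s i * s i = 1)
    (braid : ∀ i j : Fin n, j.castSucc = i.succ → s i * s j * s i = s j * s i * s j)
    (comm : ∀ i j : Fin n, (i : ℕ) + 1 < j → Commute (s i) (s j)) :
    ∃ φ : Equiv.Perm (Fin (n + 1)) →* M, ∀ i : Fin n,
      φ (Equiv.swap i.castSucc i.succ) = s i := by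
  -- The submonoid of the product generated by these pairs will be the graph of the required
  -- homomorphism.
  set t : Fin n → M × Equiv.Perm (Fin (n + 1)) :=
    fun i => (s i, Equiv.swap i.castSucc i.succ) with ht
  set g : ℕ → M × Equiv.Perm (Fin (n + 1)) := fun k => if h : k < n then t ⟨k, h⟩ else 1 with hg
  have hgt : ∀ k (h : k < n), g k = t ⟨k, h⟩ := fun k h => dif_pos h
  have hrel : CoxeterRel n g :=
    { sq := fun i hi => by
        rw [hgt i hi]
        exact Prod.ext (sq _) (Equiv.swap_mul_self _ _)
      braid := fun i hi => by
        rw [hgt i (by omega), hgt (i + 1) hi]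
        refine Prod.ext (braid _ _ rfl) (swap_braid ?_ ?_ ?_) <;>
          simp only [ne_eq, Fin.ext_iff, Fin.val_succ, Fin.val_castSucc] <;> omega
      comm := fun i j hij hj => by
        rw [hgt i (by omega), hgt j hj]
        refine Prod.ext (comm _ _ hij) (Equiv.Perm.Disjoint.commute ?_)
        refine Equiv.Perm.disjoint_swap_swap ?_
        simp [Fin.ext_iff]
        omega }
  set K := Submonoid.closure (g '' Set.Iio n)
  have hK := hrel.encard_closure_le
  have hfin : Finite K := Set.finite_of_encard_le_coe hK
  have hmem : ∀ i : Fin n, t i ∈ K := fun i =>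
    Submonoid.subset_closure ⟨i, i.2, hgt i i.2⟩
  set π : K →* Equiv.Perm (Fin (n + 1)) := (MonoidHom.snd _ _).comp K.subtype
  have hsurj : Function.Surjective π := by
    rw [← MonoidHom.mrange_eq_top, eq_top_iff, ← Equiv.Perm.mclosure_swap_castSucc_succ n,
      Submonoid.closure_le]
    rintro _ ⟨i, rfl⟩
    exact ⟨⟨t i, hmem i⟩, rfl⟩
  have hcard : Nat.card K ≤ Nat.card (Equiv.Perm (Fin (n + 1))) := by
    rw [Nat.card_perm, Nat.card_fin]
    have : ((Nat.card K : ℕ) : ℕ∞) ≤ ((n + 1).factorial : ℕ) := by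
      rw [← ENat.card_eq_coe_natCard]
      exact hK
    exact_mod_cast this
  -- The submonoid has at most `(n + 1)!` elements and maps onto a group of exactly that order, so
  -- each permutation has a single partner in `M`.
  have hbij : Function.Bijective π := hsurj.bijective_of_nat_card_le hcard
  refine ⟨((MonoidHom.fst _ _).comp K.subtype).comp (MulEquiv.ofBijective π hbij).symm.toMonoidHom,
    fun i => ?_⟩
  have : (MulEquiv.ofBijective π hbij).symm (Equiv.swap i.castSucc i.succ) = ⟨t i, hmem i⟩ := by
    rw [MulEquiv.symm_apply_eq]
    rfl
  simp [this, ht]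

end Coxeter

end VermaSing

namespace VermaSing

noncomputable section

/-! ### The space `𝒜₁` and the powers `η_i^a` -/

section A1

variable {n : ℕ}

theorem A1_le_good (n : ℕ) : A1 n ≤ good n := fun _ hf α hα i j => (hf.1 α hα i j).2

/-- Each summand of the tail moves one unit of exponent from `x_{i,k}` to `x_{i+1,k}`, so a property
transported by this move can be followed along the powers. -/
theorem etaTail_pow_support (i : Fin n) {f : Formal n} (Q : ℕ → Expo n → Prop)
    (h0 : ∀ α, f α ≠ 0 → Q 0 α)
    (hs : ∀ p α k, k < i.castSucc → Q p α →
      Q (p + 1) (α - Matrix.single i.castSucc k 1 + Matrix.single i.succ k 1))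
    (p : ℕ) (α : Expo n) (hα : (etaTail i ^ p) f α ≠ 0) : Q p α := by
  induction p generalizing α with
  | zero => exact h0 α hα
  | succ p ih =>
    rw [pow_succ', Module.End.mul_apply, etaTail, LinearMap.sum_apply, Finset.sum_apply] at hα
    obtain ⟨k, hk, hkα⟩ := Finset.exists_ne_zero_of_sum_ne_zero hα
    rw [Module.End.mul_apply, x_apply, pd_apply] at hkα
    simpa using hs p _ k (Finset.mem_Iio.1 hk) (ih _ (right_ne_zero_of_mul hkα))

theorem etaTerm_support (i : Fin n) (a : ℂ) {f : Formal n} (Q : ℕ → Expo n → Prop)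
    (h0 : ∀ α, f α ≠ 0 → Q 0 α)
    (hs : ∀ p α k, k < i.castSucc → Q p α →
      Q (p + 1) (α - Matrix.single i.castSucc k 1 + Matrix.single i.succ k 1))
    (p : ℕ) (α : Expo n) (hα : etaTerm i a p f α ≠ 0) :
    Q p (α - Matrix.single i.succ i.castSucc (a - p)) :=
  etaTail_pow_support i Q h0 hs p _ (right_ne_zero_of_mul hα)

/-- The effect of the terms of `η_i^a` on exponents. -/
theorem etaTerm_exponents (i : Fin n) (a : ℂ) {f : Formal n} (hf : f ∈ A1 n) (p : ℕ) (α : Expo n)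
    (hα : etaTerm i a p f α ≠ 0) :
    (∀ k l, k ≤ l → α k l = 0) ∧ ∃ β, f β ≠ 0 ∧
      (∀ k : Fin n, k ≠ i → ∃ m : ℕ, α k.succ k.castSucc = β k.succ k.castSucc - m) ∧
      α i.succ i.castSucc = β i.succ i.castSucc + a - p := by
  have hi := Fin.castSucc_lt_succ (i := i)
  have key := etaTerm_support i a (fun _ α => (∀ k l, k ≤ l → α k l = 0) ∧ ∃ β, f β ≠ 0 ∧
      (∀ k : Fin n, k ≠ i → ∃ m : ℕ, α k.succ k.castSucc = β k.succ k.castSucc - m) ∧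
      α i.succ i.castSucc = β i.succ i.castSucc) ?_ ?_ p α hα
  · obtain ⟨h1, β, hβ, h2, h3⟩ := key
    refine ⟨fun k l hkl => ?_, β, hβ, fun k hk => ?_, ?_⟩
    · have := h1 k l hkl
      rwa [Matrix.sub_apply, single_apply_of_ne, sub_zero] at this
      rintro ⟨rfl, rfl⟩
      exact hi.not_ge hkl
    · have := h2 k hk
      rwa [Matrix.sub_apply, single_apply_of_ne, sub_zero] at this
      rintro ⟨h, -⟩
      exact hk (Fin.succ_inj.1 h)
    · rw [Matrix.sub_apply, Matrix.single_apply_same] at h3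
      linear_combination h3
  · intro α hα
    exact ⟨fun k l => (hf.1 α hα k l).1, α, hα, fun k _ => ⟨0, by simp⟩, rfl⟩
  · rintro - α k hk ⟨h1, β, hβ, h2, h3⟩
    refine ⟨fun r s hrs => ?_, β, hβ, fun l hl => ?_, ?_⟩
    · rw [Matrix.add_apply, Matrix.sub_apply, h1 r s hrs, single_apply_of_ne, single_apply_of_ne]
      · simp
      · rintro ⟨rfl, rfl⟩
        exact (hk.trans hi).not_ge hrs
      · rintro ⟨rfl, rfl⟩
        exact hk.not_ge hrs
    · obtain ⟨m, hm⟩ := h2 l hl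
      rw [Matrix.add_apply, Matrix.sub_apply, hm, single_apply_of_ne (p := l.succ) (r := i.succ)]
      -- The only variable `x_{l+1,l}` that the tail can lower is the one in row `i.castSucc`.
      · by_cases h : l.succ = i.castSucc ∧ l.castSucc = k
        · exact ⟨m + 1, by rw [h.1, h.2, Matrix.single_apply_same]; push_cast; ring⟩
        · exact ⟨m, by rw [single_apply_of_ne h]; ring⟩
      · rintro ⟨h, -⟩
        exact hl (Fin.succ_inj.1 h)
    · rw [Matrix.add_apply, Matrix.sub_apply, h3, single_apply_of_ne, single_apply_of_ne]
      · simp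
      · exact fun h => hk.ne h.2.symm
      · exact fun h => hi.ne h.1.symm

/-- Formal sums with finitely many monomials for each choice of the exponents of the
`x_{i+1,i}`. -/
def fiberFinite (n : ℕ) : Submodule ℂ (Formal n) where
  carrier := {f | ∀ b : Fin n → ℂ,
    {α | f α ≠ 0 ∧ ∀ i : Fin n, α i.succ i.castSucc = b i}.Finite}
  zero_mem' := by simp
  add_mem' {f g} hf hg b := by
    refine ((hf b).union (hg b)).subset fun α ⟨h, h'⟩ => ?_
    by_cases hα : f α = 0
    · exact Or.inr ⟨fun hc => h (by simp [hα, hc]), h'⟩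
    · exact Or.inl ⟨hα, h'⟩
  smul_mem' c f hf b := (hf b).subset fun α h => ⟨fun hc => h.1 (by simp [hc]), h.2⟩

theorem mem_fiberFinite_of_shift {f g : Formal n} (v : Expo n)
    (h : ∀ α, g α ≠ 0 → f (α - v) ≠ 0) (hf : f ∈ fiberFinite n) : g ∈ fiberFinite n := fun b => by
  refine ((hf fun i => b i - v i.succ i.castSucc).image (· + v)).subset fun α hα => ?_
  exact ⟨α - v, ⟨h α hα.1, fun i => by simp [hα.2 i]⟩, sub_add_cancel α v⟩

theorem xpow_mem_fiberFinite (p q : Fin (n + 1)) (c : ℂ) {f : Formal n} (hf : f ∈ fiberFinite n) :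
    xpow p q c f ∈ fiberFinite n :=
  mem_fiberFinite_of_shift (Matrix.single p q c) (fun _ h => h) hf

theorem pd_mem_fiberFinite (p q : Fin (n + 1)) {f : Formal n} (hf : f ∈ fiberFinite n) :
    pd p q f ∈ fiberFinite n :=
  mem_fiberFinite_of_shift (-Matrix.single p q 1)
    (fun α h => by rw [sub_neg_eq_add]; exact right_ne_zero_of_mul h) hf

theorem etaTerm_mem_fiberFinite (i : Fin n) (a : ℂ) (p : ℕ) {f : Formal n}
    (hf : f ∈ fiberFinite n) : etaTerm i a p f ∈ fiberFinite n := by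
  suffices h : (etaTail i ^ p) f ∈ fiberFinite n from
    Submodule.smul_mem _ _ (xpow_mem_fiberFinite _ _ _ h)
  induction p with
  | zero => exact hf
  | succ p ih =>
    rw [pow_succ', Module.End.mul_apply, etaTail, LinearMap.sum_apply]
    exact Submodule.sum_mem _ fun k _ => xpow_mem_fiberFinite _ _ _ (pd_mem_fiberFinite _ _ ih)

theorem eta_mem_A1 (i : Fin n) (a : ℂ) {f : Formal n} (hf : f ∈ A1 n) : eta i a f ∈ A1 n := by
  have hgood := A1_le_good n hf
  obtain ⟨T, hT⟩ := hf.2.1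
  refine ⟨fun α hα k l => ⟨?_, eta_mem_good i a hgood α hα k l⟩,
    ⟨T.image (· + Pi.single i a), fun α hα => ?_⟩, fun b => ?_⟩
  · obtain ⟨p, hp⟩ := eta_apply_ne_zero hα
    exact (etaTerm_exponents i a hf p α hp).1 k l
  · obtain ⟨p, hp⟩ := eta_apply_ne_zero hα
    obtain ⟨-, β, hβ, h2, h3⟩ := etaTerm_exponents i a hf p α hp
    obtain ⟨t, ht, htβ⟩ := hT β hβ
    refine ⟨t + Pi.single i a, Finset.mem_image_of_mem _ ht, fun k => ?_⟩
    obtain ⟨m, hm⟩ := htβ k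
    by_cases hk : k = i
    · subst hk
      exact ⟨m + p, by rw [h3, hm]; simp; ring⟩
    · obtain ⟨m', hm'⟩ := h2 k hk
      exact ⟨m + m', by rw [hm', hm]; simp [hk]; ring⟩
  -- If term `p` contributes at exponents `b`, then `t i + a - b i = p + m` for some `t ∈ T` and
  -- some natural `m`. As `T` is finite this bounds `p` uniformly, and a finite partial sum
  -- suffices.
  · obtain ⟨P, hP⟩ : ∃ P : ℕ, ∀ t ∈ T, ‖t i + a - b i‖ < P := by
      obtain ⟨P, hP⟩ := (T.image fun t => ⌊‖t i + a - b i‖⌋₊ + 1).exists_le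
      refine ⟨P, fun t ht => (Nat.lt_floor_add_one _).trans_le ?_⟩
      exact_mod_cast hP _ (Finset.mem_image_of_mem _ ht)
    have hsum : ∑ p ∈ Finset.range P, etaTerm i a p f ∈ fiberFinite n :=
      Submodule.sum_mem _ fun p _ => etaTerm_mem_fiberFinite i a p hf.2.2
    refine (hsum b).subset fun α ⟨hα, hb⟩ => ⟨fun h0 => hα ?_, hb⟩
    rw [eta_apply_eq_sum a hgood (le_max_left (cut i α) P), ← h0, Finset.sum_apply]
    refine (Finset.sum_subset (Finset.range_mono (le_max_right _ _)) fun p _ hp => ?_).symm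
    by_contra hne
    obtain ⟨-, β, hβ, -, h3⟩ := etaTerm_exponents i a hf p α hne
    obtain ⟨t, ht, htβ⟩ := hT β hβ
    obtain ⟨m, hm⟩ := htβ i
    have h4 : t i + a - b i = ((p + m : ℕ) : ℂ) := by
      rw [hb i, hm] at h3
      push_cast
      linear_combination -h3
    have h5 := hP t ht
    rw [h4, Complex.norm_natCast] at h5
    have h6 : p + m < P := by exact_mod_cast h5
    simp at hp
    omega

end A1

/-! ### Weights -/

section Weight

variable {n : ℕ}

theorem wt_add (lam : Fin n → ℂ) (α β : Expo n) : wt lam (α + β) = wt lam α + wt 0 β := by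
  ext i
  simp only [wt, Matrix.add_apply, Pi.add_apply, Pi.zero_apply, Finset.sum_sub_distrib,
    Finset.sum_add_distrib]
  ring

theorem wt_zero_smul (c : ℂ) (α : Expo n) : wt 0 (c • α) = c • wt 0 α := by
  ext i
  simp only [wt, Matrix.smul_apply, Pi.smul_apply, Pi.zero_apply, smul_eq_mul, mul_add, mul_sub,
    Finset.sum_sub_distrib, Finset.mul_sum]
  ring

/-- The `i`-th fundamental coroot, on the coordinates of the diagonal torus. -/
def coroot (i : Fin n) (p : Fin (n + 1)) : ℂ :=
  (if p = i.castSucc then 1 else 0) - (if p = i.succ then 1 else 0)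

/-- Multiplication by `x_{p,q}` shifts the weight by `ε_p - ε_q`, evaluated here on the simple
coroots. -/
theorem wt_zero_single {p q : Fin (n + 1)} (h : q < p) (i : Fin n) :
    wt 0 (Matrix.single p q 1) i = coroot i p - coroot i q := by
  have h1 : ∀ r, ∑ k ∈ Finset.Iio i.castSucc, (Matrix.single p q (1 : ℂ)) r k
      = if p = r ∧ q < i.castSucc then 1 else 0 := fun r => by
    simp [Matrix.single_apply, ite_and]
  have h2 : ∀ r, ∑ k ∈ Finset.Ioi i.succ, (Matrix.single p q (1 : ℂ)) k r
      = if q = r ∧ i.succ < p then 1 else 0 := fun r => by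
    simp only [Matrix.single_apply, ite_and, Finset.sum_ite_eq, Finset.mem_Ioi]
    split_ifs <;> rfl
  simp only [wt, Finset.sum_sub_distrib, h1, h2]
  simp only [coroot, Matrix.single_apply, Pi.zero_apply, Fin.ext_iff, Fin.lt_def, Fin.val_succ,
    Fin.val_castSucc] at h ⊢
  split_ifs <;> first | omega | norm_num

/-- The weight of `η_i`, i.e. the negative of the `i`-th simple root. -/
def negRoot (i : Fin n) : Fin n → ℂ := wt 0 (Matrix.single i.succ i.castSucc 1)

theorem negRoot_apply (i k : Fin n) :
    negRoot i k = coroot k i.succ - coroot k i.castSucc :=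
  wt_zero_single Fin.castSucc_lt_succ k

theorem negRoot_self (i : Fin n) : negRoot i i = -2 := by
  have h := (Fin.castSucc_lt_succ (i := i)).ne
  simp [negRoot_apply, coroot, h, h.symm]
  norm_num

theorem negRoot_of_eq {i j : Fin n} (hij : j.castSucc = i.succ) :
    negRoot i j = 1 ∧ negRoot j i = 1 := by
  have h1 := Fin.castSucc_lt_succ (i := i)
  have h2 := Fin.castSucc_lt_succ (i := j)
  rw [hij] at h2
  simp [negRoot_apply, coroot, hij, h1.ne, h1.ne', h2.ne, h2.ne', (h1.trans h2).ne,
    (h1.trans h2).ne']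

theorem negRoot_of_lt {i j : Fin n} (hij : (i : ℕ) + 1 < j) :
    negRoot i j = 0 ∧ negRoot j i = 0 := by
  simp only [negRoot_apply, coroot, Fin.ext_iff, Fin.val_succ, Fin.val_castSucc]
  constructor <;> (split_ifs <;> first | omega | norm_num)

theorem wt_shift (lam : Fin n → ℂ) {i : Fin n} {k : Fin (n + 1)} (hk : k < i.castSucc)
    (α : Expo n) :
    wt lam (α - Matrix.single i.castSucc k 1 + Matrix.single i.succ k 1)
      = wt lam α + negRoot i := by
  have h1 := wt_add lam (α - Matrix.single i.castSucc k 1) (Matrix.single i.castSucc k 1)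
  rw [sub_add_cancel] at h1
  rw [wt_add, h1]
  ext l
  have h2 := wt_zero_single hk l
  have h3 := wt_zero_single (hk.trans (Fin.castSucc_lt_succ (i := i))) l
  simp only [Pi.add_apply, h2, h3, negRoot_apply]
  ring

theorem wt_sub_single (lam : Fin n → ℂ) (i : Fin n) (c : ℂ) (α : Expo n) :
    wt lam α = wt lam (α - Matrix.single i.succ i.castSucc c) + c • negRoot i := by
  have h := wt_add lam (α - Matrix.single i.succ i.castSucc c) (Matrix.single i.succ i.castSucc c)
  rw [sub_add_cancel] at h
  have h2 : Matrix.single i.succ i.castSucc c = c • Matrix.single i.succ i.castSucc (1 : ℂ) := by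
    rw [Matrix.smul_single, smul_eq_mul, mul_one]
  rw [h, negRoot, ← wt_zero_smul, ← h2]

theorem hasWeight_iff {lam μ : Fin n → ℂ} {f : Formal n} :
    HasWeight lam μ f ↔ ∀ α, f α ≠ 0 → wt lam α = μ := by
  constructor
  · intro h α hα
    ext i
    have := congrFun (h i) α
    rw [zeta_apply, Pi.smul_apply, smul_eq_mul] at this
    exact mul_right_cancel₀ hα this
  · intro h i
    ext α
    rw [zeta_apply, Pi.smul_apply, smul_eq_mul]
    by_cases hα : f α = 0
    · simp [hα]
    · rw [h α hα]

theorem hasWeight_eta {lam μ : Fin n → ℂ} {f : Formal n} (hf : HasWeight lam μ f) (i : Fin n)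
    (a : ℂ) : HasWeight lam (μ + a • negRoot i) (eta i a f) := by
  rw [hasWeight_iff] at hf ⊢
  intro α hα
  obtain ⟨p, hp⟩ := eta_apply_ne_zero hα
  have := etaTerm_support i a (fun p α => wt lam α = μ + (p : ℂ) • negRoot i)
    (fun α h => by simp [hf α h])
    (fun p α k hk h => by rw [wt_shift lam hk, h]; push_cast; module) p α hp
  rw [wt_sub_single lam i (a - p), this]
  module

theorem wtComp_apply (lam μ : Fin n → ℂ) (f : Formal n) (α : Expo n) [Decidable (wt lam α = μ)] :
    wtComp lam μ f α = if wt lam α = μ then f α else 0 := by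
  simp only [wtComp, LinearMap.coe_mk, AddHom.coe_mk]
  congr

theorem wtComp_of_hasWeight {lam μ : Fin n → ℂ} {f : Formal n} (hf : HasWeight lam μ f)
    (ν : Fin n → ℂ) [Decidable (ν = μ)] : wtComp lam ν f = if ν = μ then f else 0 := by
  classical
  rw [hasWeight_iff] at hf
  ext α
  rw [wtComp_apply]
  by_cases hα : f α = 0
  · split_ifs <;> simp [hα]
  · rw [hf α hα]
    split_ifs with h1 h2 h2 <;> first | rfl | exact absurd h1.symm h2 | exact absurd h2.symm h1

theorem ext_wtComp (lam : Fin n → ℂ) {f g : Formal n}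
    (h : ∀ ν, wtComp lam ν f = wtComp lam ν g) : f = g := by
  classical
  ext α
  simpa [wtComp_apply] using congrFun (h (wt lam α)) α

/-- The dot action of the `i`-th simple reflection on weights. -/
def dot (i : Fin n) (μ : Fin n → ℂ) : Fin n → ℂ := μ + (μ i + 1) • negRoot i

theorem dot_eq (i : Fin n) (μ : Fin n → ℂ) : dot i μ = μ + (μ i + 1) • negRoot i := rfl

theorem dot_apply (i k : Fin n) (μ : Fin n → ℂ) : dot i μ k = μ k + (μ i + 1) * negRoot i k := rfl

theorem dot_self (i : Fin n) (μ : Fin n → ℂ) : dot i μ i + 1 = -(μ i + 1) := by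
  rw [dot_apply, negRoot_self]; ring

theorem dot_dot (i : Fin n) (μ : Fin n → ℂ) : dot i (dot i μ) = μ := by
  rw [dot, dot_self, dot]
  module

end Weight

/-! ### The operators `σ_i` -/

section Sigma

variable {n : ℕ} (lam : Fin n → ℂ)

/-- The operator `σ_i`, as a linear operator on all formal sums. -/
def sigmaEnd (i : Fin n) : Module.End ℂ (Formal n) where
  -- `η_i^{μ_i+1}` sends weight `μ` to `dot i μ`, and `dot i` is an involution, so only `μ = dot i
  -- (wt lam α)` can reach `x^α`.
  toFun f := fun α => eta i (dot i (wt lam α) i + 1) (wtComp lam (dot i (wt lam α)) f) α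
  map_add' f g := by ext α; simp
  map_smul' c f := by ext α; simp

theorem sigmaEnd_apply (i : Fin n) (f : Formal n) (α : Expo n) :
    sigmaEnd lam i f α = eta i (dot i (wt lam α) i + 1) (wtComp lam (dot i (wt lam α)) f) α := rfl

variable {lam}

theorem eta_eq_zero_of_ne {μ : Fin n → ℂ} {f : Formal n} (hf : HasWeight lam μ f) (i : Fin n)
    {α : Expo n} (h : μ ≠ dot i (wt lam α)) : eta i (μ i + 1) f α = 0 := by
  by_contra hα
  have := hasWeight_iff.1 (hasWeight_eta hf i (μ i + 1)) α hα
  exact h (by rw [this]; exact (dot_dot i μ).symm)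

theorem wtComp_mem_A1 {f : Formal n} (hf : f ∈ A1prod lam) (μ : Fin n → ℂ) :
    wtComp lam μ f ∈ A1 n := (Submodule.mem_iInf _).1 hf μ

theorem etaPow_wtComp {f : Formal n} (hf : f ∈ A1prod lam) (i : Fin n) (a : ℂ) (μ : Fin n → ℂ) :
    etaPow i a (wtComp lam μ f) = eta i a (wtComp lam μ f) :=
  etaPow_eq_eta i a (A1_le_good n (wtComp_mem_A1 hf μ))

theorem finite_etaPow_wtComp {f : Formal n} (hf : f ∈ A1prod lam) (i : Fin n) (α : Expo n) :
    {μ : Fin n → ℂ | etaPow i (μ i + 1) (wtComp lam μ f) α ≠ 0}.Finite := by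
  refine (Set.finite_singleton (dot i (wt lam α))).subset fun μ hμ => ?_
  rw [Set.mem_ofPred_eq, etaPow_wtComp hf] at hμ
  by_contra h
  exact hμ (eta_eq_zero_of_ne (hasWeight_wtComp lam μ f) i h)

theorem sigma_eq_sigmaEnd {f : Formal n} (hf : f ∈ A1prod lam) (i : Fin n) :
    sigma lam i f = sigmaEnd lam i f := by
  ext α
  rw [sigma, sigmaEnd_apply, finsum_eq_single _ (dot i (wt lam α)), etaPow_wtComp hf]
  intro μ hμ
  rw [etaPow_wtComp hf]
  exact eta_eq_zero_of_ne (hasWeight_wtComp lam μ f) i hμ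

theorem sigmaEnd_of_hasWeight {μ : Fin n → ℂ} {f : Formal n} (hf : HasWeight lam μ f)
    (i : Fin n) : sigmaEnd lam i f = eta i (μ i + 1) f := by
  classical
  ext α
  rw [sigmaEnd_apply, wtComp_of_hasWeight hf]
  split_ifs with h
  · rw [h]
  · rw [map_zero, eta_eq_zero_of_ne hf i (Ne.symm h)]
    rfl

/-- Reduces every relation between the `σ_i` to one between complex powers on a single weight
component, with exponents read off backwards from the target weight `ν`. -/
theorem wtComp_sigmaEnd (i : Fin n) (ν : Fin n → ℂ) (f : Formal n) :
    wtComp lam ν (sigmaEnd lam i f)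
      = eta i (dot i ν i + 1) (wtComp lam (dot i ν) f) := by
  classical
  ext α
  rw [wtComp_apply]
  split_ifs with h
  · rw [sigmaEnd_apply, h]
  · refine (eta_eq_zero_of_ne (hasWeight_wtComp lam (dot i ν) f) i fun h' => h ?_).symm
    rw [← dot_dot i ν, h', dot_dot]

theorem sigmaEnd_mem_A1prod (i : Fin n) {f : Formal n} (hf : f ∈ A1prod lam) :
    sigmaEnd lam i f ∈ A1prod lam := by
  rw [A1prod, Submodule.mem_iInf]
  intro ν
  rw [Submodule.mem_comap, wtComp_sigmaEnd]
  exact eta_mem_A1 i _ (wtComp_mem_A1 hf _)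

theorem sigmaEnd_sigmaEnd (i : Fin n) {f : Formal n} (hf : f ∈ A1prod lam) :
    sigmaEnd lam i (sigmaEnd lam i f) = f := by
  refine ext_wtComp lam fun ν => ?_
  have hg := A1_le_good n (wtComp_mem_A1 hf ν)
  rw [wtComp_sigmaEnd, wtComp_sigmaEnd, dot_dot, eta_eta i _ _ hg, dot_self, neg_add_cancel,
    eta_zero i hg]

theorem sigmaEnd_braid {i j : Fin n} (hij : j.castSucc = i.succ) {f : Formal n}
    (hf : f ∈ A1prod lam) :
    sigmaEnd lam i (sigmaEnd lam j (sigmaEnd lam i f))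
      = sigmaEnd lam j (sigmaEnd lam i (sigmaEnd lam j f)) := by
  obtain ⟨h1, h2⟩ := negRoot_of_eq hij
  refine ext_wtComp lam fun ν => ?_
  simp only [wtComp_sigmaEnd]
  have e1 : dot j (dot i ν) i + 1 = ν j + 1 := by
    simp only [dot_apply, h1, h2, negRoot_self]; ring
  have e2 : dot i (dot j ν) j + 1 = ν i + 1 := by
    simp only [dot_apply, h1, h2, negRoot_self]; ring
  have e3 : dot i ν j + 1 = ν i + ν j + 2 := by simp only [dot_apply, h1]; ring
  have e4 : dot j ν i + 1 = ν i + ν j + 2 := by simp only [dot_apply, h2]; ring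
  have e5 : dot i (dot j (dot i ν)) = dot j (dot i (dot j ν)) := by
    rw [dot_eq i (dot j (dot i ν)), e1, dot_eq j (dot i ν), e3, dot_eq i ν,
      dot_eq j (dot i (dot j ν)), e2, dot_eq i (dot j ν), e4, dot_eq j ν]
    module
  rw [dot_self i (dot j (dot i ν)), dot_self j (dot i (dot j ν)), e1, e2, e5,
    dot_self j (dot i ν), dot_self i (dot j ν), e3, e4, dot_self i, dot_self j]
  -- By `dot_self` the exponents are the negatives of those computed above: `-(ν i + 1)` and `-(ν j
  -- + 1)` at the ends, their sum in the middle.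
  have h := eta_braid hij (-(ν i + 1)) (-(ν j + 1))
    (A1_le_good n (wtComp_mem_A1 hf (dot j (dot i (dot j ν)))))
  rw [show -(ν i + 1) + -(ν j + 1) = -(ν i + ν j + 2) by ring] at h
  exact h

theorem sigmaEnd_comm {i j : Fin n} (hij : (i : ℕ) + 1 < j) {f : Formal n}
    (hf : f ∈ A1prod lam) :
    sigmaEnd lam i (sigmaEnd lam j f) = sigmaEnd lam j (sigmaEnd lam i f) := by
  obtain ⟨h1, h2⟩ := negRoot_of_lt hij
  refine ext_wtComp lam fun ν => ?_
  simp only [wtComp_sigmaEnd]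
  have e1 : dot i ν j = ν j := by simp [dot_apply, h1]
  have e2 : dot j ν i = ν i := by simp [dot_apply, h2]
  have e3 : dot j (dot i ν) = dot i (dot j ν) := by
    rw [dot, e1, dot, dot, e2, dot]
    module
  rw [dot_self j (dot i ν), dot_self i (dot j ν), e1, e2, e3, dot_self, dot_self]
  refine eta_comm ?_ ?_ _ _ (A1_le_good n (wtComp_mem_A1 hf _)) <;>
  · simp only [ne_eq, Fin.ext_iff, Fin.val_succ, Fin.val_castSucc]
    omega

theorem sigmaEnd_mem_A1fin (i : Fin n) {f : Formal n} (hf : f ∈ A1fin lam) :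
    sigmaEnd lam i f ∈ A1fin lam := by
  suffices h : A1fin lam ≤ (A1fin lam).comap (sigmaEnd lam i) from h hf
  refine Submodule.span_le.2 ?_
  rintro g ⟨hg, μ, hμ⟩
  rw [SetLike.mem_coe, Submodule.mem_comap, sigmaEnd_of_hasWeight hμ]
  exact Submodule.subset_span ⟨eta_mem_A1 i _ hg, _, hasWeight_eta hμ i _⟩

/-! ### The constant `1` as a singular vector, and the `σ_i` on the product of weight spaces. -/

theorem pd_one (p q : Fin (n + 1)) : pd p q (one n) = 0 := by
  ext α
  rw [pd_apply, one, Pi.single_apply]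
  split_ifs with h
  · have := congrFun (congrFun h p) q
    rw [Matrix.add_apply, Matrix.single_apply_same] at this
    rw [this]
    simp
  · simp

theorem d_one (lam : Fin n → ℂ) (i : Fin n) : d lam i (one n) = 0 := by
  simp [d, LinearMap.sum_apply, Module.End.mul_apply, pd_one]

theorem hasWeight_one (lam : Fin n → ℂ) : HasWeight lam lam (one n) := by
  rw [hasWeight_iff]
  intro α hα
  have : α = 0 := by
    by_contra hc
    exact hα (by simp [one, hc])
  ext i
  simp [this, wt]

/-- The operator `σ_i` on the product of the weight spaces of `𝒜₁`. -/
def sigmaA1prod (lam : Fin n → ℂ) (i : Fin n) : Module.End ℂ (A1prod lam) :=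
  (sigmaEnd lam i).restrict fun _ hf => sigmaEnd_mem_A1prod i hf

theorem coe_sigmaA1prod (lam : Fin n → ℂ) (i : Fin n) (f : A1prod lam) :
    (sigmaA1prod lam i f : Formal n) = sigmaEnd lam i f := rfl

theorem sigmaA1prod_mul_self (lam : Fin n → ℂ) (i : Fin n) :
    sigmaA1prod lam i * sigmaA1prod lam i = 1 :=
  LinearMap.ext fun f => Subtype.ext <| by
    rw [Module.End.mul_apply, coe_sigmaA1prod, coe_sigmaA1prod, sigmaEnd_sigmaEnd i f.2,
      Module.End.one_apply]

theorem sigmaA1prod_braid (lam : Fin n → ℂ) {i j : Fin n} (hij : j.castSucc = i.succ) :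
    sigmaA1prod lam i * sigmaA1prod lam j * sigmaA1prod lam i
      = sigmaA1prod lam j * sigmaA1prod lam i * sigmaA1prod lam j :=
  LinearMap.ext fun f => Subtype.ext <| by
    simp only [Module.End.mul_apply, coe_sigmaA1prod]
    exact sigmaEnd_braid hij f.2

theorem commute_sigmaA1prod (lam : Fin n → ℂ) {i j : Fin n} (hij : (i : ℕ) + 1 < j) :
    Commute (sigmaA1prod lam i) (sigmaA1prod lam j) :=
  LinearMap.ext fun f => Subtype.ext <| by
    simp only [Module.End.mul_apply, coe_sigmaA1prod]
    exact sigmaEnd_comm hij f.2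

theorem perm_induction {P : Equiv.Perm (Fin (n + 1)) → Prop} (one : P 1)
    (mul : ∀ (i : Fin n) s, P s → P (Equiv.swap i.castSucc i.succ * s))
    (s : Equiv.Perm (Fin (n + 1))) : P s := by
  have hs : s ∈ Submonoid.closure
      (Set.range fun i : Fin n => Equiv.swap i.castSucc i.succ) := by
    rw [Equiv.Perm.mclosure_swap_castSucc_succ]
    trivial
  induction hs using Submonoid.closure_induction_left with
  | one => exact one
  | mul_left t ht s _ ih =>
    obtain ⟨i, rfl⟩ := ht
    exact mul i s ih

end Sigma

end

end VermaSing

/-! ### Assembly of the theorem. -/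

theorem theorem2p5 (n : ℕ) (lam : Fin n → ℂ) :
    -- the complex powers of the `η_i` are well defined operators on `𝒜₁`
    (∀ (i : Fin n) (a : ℂ) (f : VermaSing.Formal n), f ∈ VermaSing.A1 n →
      (∀ α, {p : ℕ | VermaSing.etaTerm i a p f α ≠ 0}.Finite) ∧
      VermaSing.etaPow i a f ∈ VermaSing.A1 n) ∧
    -- the sums that define the `σ_i` are coefficientwise finite
    (∀ (i : Fin n) (f : VermaSing.Formal n), f ∈ VermaSing.A1prod lam → ∀ α,
      {μ : Fin n → ℂ |
        VermaSing.etaPow i (μ i + 1) (VermaSing.wtComp lam μ f) α ≠ 0}.Finite) ∧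
    -- the `σ_i` give a representation of the symmetric group
    ∃ ρ : Representation ℂ (Equiv.Perm (Fin (n + 1))) (VermaSing.A1prod lam),
      (∀ (i : Fin n) (f : VermaSing.A1prod lam),
        (ρ (Equiv.swap i.castSucc i.succ) f : VermaSing.Formal n) = VermaSing.sigma lam i f) ∧
      (∀ (i : Fin n) (μ : Fin n → ℂ) (f : VermaSing.A1prod lam),
        (f : VermaSing.Formal n) ∈ VermaSing.A1 n → VermaSing.HasWeight lam μ f →
        (ρ (Equiv.swap i.castSucc i.succ) f : VermaSing.Formal n)
          = VermaSing.etaPow i (μ i + 1) f) ∧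
      -- it restricts to the direct sum of the weight spaces of `𝒜₁`
      (∀ (s : Equiv.Perm (Fin (n + 1))) (f : VermaSing.A1prod lam),
        (f : VermaSing.Formal n) ∈ VermaSing.A1fin lam →
        (ρ s f : VermaSing.Formal n) ∈ VermaSing.A1fin lam) ∧
      -- the `σ(1)` are weighted solutions, in `𝒜₁`, of the system for singular vectors
      (∀ s : Equiv.Perm (Fin (n + 1)),
        (ρ s (VermaSing.oneA1 lam) : VermaSing.Formal n) ∈ VermaSing.A1 n ∧
        (∃ μ : Fin n → ℂ,
          VermaSing.HasWeight lam μ (ρ s (VermaSing.oneA1 lam) : VermaSing.Formal n)) ∧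
        ∀ i : Fin n,
          VermaSing.d lam i (ρ s (VermaSing.oneA1 lam) : VermaSing.Formal n) = 0) := by
  open VermaSing in
  refine ⟨fun i a f hf => ⟨finite_etaTerm_ne_zero i a (A1_le_good n hf), ?_⟩,
    fun i f hf => finite_etaPow_wtComp hf i, ?_⟩
  · rw [etaPow_eq_eta i a (A1_le_good n hf)]
    exact eta_mem_A1 i a hf
  obtain ⟨ρ, hρ⟩ := exists_monoidHom_of_coxeterRel (sigmaA1prod lam)
    (sigmaA1prod_mul_self lam) (fun _ _ => sigmaA1prod_braid lam)
    (fun _ _ => commute_sigmaA1prod lam)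
  have hmul : ∀ (i : Fin n) s (f : A1prod lam),
      (ρ (Equiv.swap i.castSucc i.succ * s) f : Formal n) = sigmaEnd lam i (ρ s f) := by
    intro i s f
    rw [map_mul, hρ]
    rfl
  refine ⟨ρ, fun i f => ?_, fun i μ f hf hμ => ?_, fun s f hf => ?_, fun s => ?_⟩
  · rw [hρ, coe_sigmaA1prod, sigma_eq_sigmaEnd f.2]
  · rw [hρ, coe_sigmaA1prod, sigmaEnd_of_hasWeight hμ, etaPow_eq_eta i _ (A1_le_good n hf)]
  · induction s using perm_induction with
    | one => simpa using hf
    | mul i s ih =>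
      rw [hmul]
      exact sigmaEnd_mem_A1fin i ih
  -- The three properties are carried together: being weighted reduces `σ_i` to a single power
  -- `η_i^{μ_i+1}`, to which the results on `𝒜₁` and on singular vectors apply.
  · induction s using perm_induction with
    | one =>
      have h1 : (ρ 1 (oneA1 lam) : Formal n) = one n := by rw [map_one]; rfl
      rw [h1]
      exact ⟨one_mem_A1 n, ⟨lam, hasWeight_one lam⟩, d_one lam⟩
    | mul i s ih =>
      obtain ⟨h1, ⟨μ, hμ⟩, h2⟩ := ih
      rw [hmul, sigmaEnd_of_hasWeight hμ]
      exact ⟨eta_mem_A1 i _ h1, ⟨_, hasWeight_eta hμ i _⟩,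
        d_eta_eq_zero (A1_le_good n h1) hμ h2 i⟩
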